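/- Let $\beta>1$ be a Pisot unit, i.e. a real algebraic integer all of whose other conjugates have modulus $<1$ and whose minimal polynomial $g(x)=x^m-k_1x^{m-1}-\dots-k_m\in\mathbb Z[x]$ satisfies $k_m=\pm1$. The greedy digits of $x$ are $\varepsilon_1(x)=\lfloor\beta x\rfloor$, $\varepsilon_2(x)=\lfloor\beta\{\beta x\}\rfloor$, and so on; for $x\in[0,1)$ they form the $\beta$-expansion $x=\sum_{k\ge1}\varepsilon_k(x)\beta^{-k}$, and the expansion is extended to all reals $x\ge0$, as a two-sided sequence with only zeros far to the left, by expanding $x\beta^{-N}\in[0,1)$ and shifting by $N$ places. Assume that $\beta$ is finitary: the $x\in[0,1)$ with finite $\beta$-expansion are exactly the elements of $\mathbb Z[\beta]\cap[0,1)$. Let $(d'_n)_{n\ge1}$ be the greedy digits of $1$. Put $d=d'$ if $d'$ has infinitely many nonzero terms, and otherwise let $d$ be the periodic sequence with period $d'_1,\dots,d'_{k-1},d'_k-1$, where $d'_k$ is the last nonzero digit. Let $X_\beta$ be the set of two-sided sequences $\varepsilon=(\varepsilon_n)_{n\in\mathbb Z}$ of nonnegative integers such that $(\varepsilon_n,\varepsilon_{n+1},\dots)$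 is strictly lexicographically smaller than $(d_1,d_2,\dots)$ for every $n\in\mathbb Z$. Let $T$ be the automorphism of $\mathbb T^m=\mathbb R^m/\mathbb Z^m$ given by the companion matrix of $g$ with first row $(k_1,\dots,k_m)$ and ones below the diagonal, let $\xi_0=1/g'(\beta)$, and for $\varepsilon\in X_\beta$ put $$\varphi_0(\varepsilon)=\sum_{k\in\mathbb Z}\varepsilon_kT^{-k}(\xi_0,\xi_0\beta^{-1},\dots,\xi_0\beta^{-m+1}),\qquad \varphi(\varepsilon)=\sum_{k\in\mathbb Z}\varepsilon_kT^{-k}(1,\beta^{-1},\dots,\beta^{-m+1})$$ in $\mathbb T^m$. Write $\varepsilon\sim\varepsilon'$ if $\varphi_0(\varepsilon)=\varphi_0(\varepsilon')$, and let $X'_\beta=X_\beta/{\sim}$. Let $\mathcal P_\beta=\{\xi\in\mathbb R:\|\xi\beta^n\|\to0\text{ as }n\to+\infty\}$, where $\|\cdot\|$ is the distance to the nearest integer, and let $\mathcal A_\beta=\mathcal P_\beta/\mathbb Z[\beta]$ be the Pisot group. For $a\in\mathcal A_\beta$ let $\mathfrak g(a)\subset X_\beta$ be the set of all purely periodic sequences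 in $X_\beta$ that agree at all sufficiently large indices with the $\beta$-expansion of some nonnegative $\xi\in a$. The symbolic Pisot group is $\mathfrak A_\beta=\{\mathfrak g(a):a\in\mathcal A_\beta\}$, with the addition carried over from $\mathcal A_\beta$ by $\mathfrak g$. Theorem. The series defining $\varphi_0$ and $\varphi$ converge, $\varphi_0$ induces a bijection $X'_\beta\to\mathbb T^m$, and $X'_\beta$ is given the group structure carried over from $\mathbb T^m$ by this bijection. Then: (1) $\varphi$ is well defined on $X'_\beta$: if $\varphi_0(\varepsilon)=\varphi_0(\varepsilon')$, then $\varphi(\varepsilon)=\varphi(\varepsilon')$. (2) The induced map $\varphi:X'_\beta\to\mathbb T^m$ is a group homomorphism, and its kernel is equal to $\mathfrak A_\beta$: the $\sim$-classes that form the kernel are exactly the sets $\mathfrak g(a)$, $a\in\mathcal A_\beta$, and $a\mapsto\mathfrak g(a)$ is a group isomorphism of $\mathcal A_\beta$ onto the kernel. -/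

import Mathlib

open Polynomial Filter Topology

namespace PisotCoding

/-! ### Pisot units -/

/-- `β > 1` is an algebraic integer all of whose other conjugates have modulus `< 1`, and the
constant coefficient of its minimal polynomial is `±1`. -/
structure IsPisotUnit (β : ℝ) : Prop where
  one_lt : 1 < β
  isIntegral : IsIntegral ℤ β
  conj_lt : ∀ z : ℂ, aeval z (minpoly ℤ β) = 0 → z ≠ (β : ℂ) → ‖z‖ < 1
  unit : IsUnit ((minpoly ℤ β).coeff 0)

/-- The degree `m` of `β`. -/
noncomputable def deg (β : ℝ) : ℕ := (minpoly ℤ β).natDegree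

/-- The ring `ℤ[β]`, as an additive subgroup of `ℝ`. -/
noncomputable def ringZ (β : ℝ) : AddSubgroup ℝ :=
  (Algebra.adjoin ℤ ({β} : Set ℝ)).toSubring.toAddSubgroup

/-! ### The Pisot group -/

/-- `𝒫_β = {ξ ∈ ℝ : ‖ξ βⁿ‖ → 0 as n → +∞}`, where the distance to the nearest integer is the norm
of the image in `ℝ/ℤ`. -/
noncomputable def pisotP (β : ℝ) : AddSubgroup ℝ where
  carrier := {ξ | Tendsto (fun n : ℕ => ‖((ξ * β ^ n : ℝ) : UnitAddCircle)‖) atTop (𝓝 0)}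
  zero_mem' := by simp
  add_mem' := by
    intro a b ha hb
    have h := Tendsto.add ha hb
    rw [add_zero] at h
    refine squeeze_zero (fun _ => norm_nonneg _) (fun n => ?_) h
    rw [add_mul, AddCircle.coe_add]
    exact norm_add_le _ _
  neg_mem' := by
    intro a ha
    simpa [neg_mul, AddCircle.coe_neg] using ha

/-- The Pisot group `𝒜_β = 𝒫_β / ℤ[β]`. -/
abbrev PisotGroup (β : ℝ) : Type :=
  pisotP β ⧸ (ringZ β).addSubgroupOf (pisotP β)

/-! ### `β`-expansions and the two-sided `β`-compactum -/

/-- The digits of the greedy algorithm started at `x`, indexed from `0`: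
`digit β x n` is `ε_{n+1}(x)`, that is `ε₁ = [βx]`, `ε₂ = [β{βx}]`, and so on. -/
noncomputable def digit (β x : ℝ) (n : ℕ) : ℕ :=
  ⌊β * (fun y : ℝ => Int.fract (β * y))^[n] x⌋₊

/-- `β` is finitary: the elements of `[0,1)` with a finite greedy expansion are exactly those of
`ℤ[β] ∩ [0,1)`. -/
def IsFinitary (β : ℝ) : Prop :=
  {x : ℝ | x ∈ Set.Ico (0 : ℝ) 1 ∧ ∃ K, ∀ n ≥ K, digit β x n = 0} =
    (ringZ β : Set ℝ) ∩ Set.Ico (0 : ℝ) 1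

open Classical in
/-- The sequence `d` (indexed from `0`): the greedy expansion `d'` of `1` if that is infinite; if
`d'` has last nonzero digit `d'_k`, the periodic sequence with period
`d'_1, …, d'_{k-1}, d'_k - 1`. -/
noncomputable def quasiGreedy (β : ℝ) (n : ℕ) : ℕ :=
  if h : ∃ K, ∀ j ≥ K, digit β 1 j = 0 then
    if n % Nat.find h + 1 = Nat.find h then digit β 1 (n % Nat.find h) - 1
    else digit β 1 (n % Nat.find h)
  else digit β 1 n

/-- Strict lexicographic order `x ≺ y`. -/
def LexLT (x y : ℕ → ℕ) : Prop :=
  ∃ n, (∀ i < n, x i = y i) ∧ x n < y n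

/-- The two-sided `β`-compactum: `(ε_n, ε_{n+1}, …) ≺ (d_1, d_2, …)` for all `n ∈ ℤ`. -/
def compactum (β : ℝ) : Set (ℤ → ℕ) :=
  {ε | ∀ n : ℤ, LexLT (fun i : ℕ => ε (n + i)) (quasiGreedy β)}

/-- `ε` is the `β`-expansion `x = ∑ ε_k β^{-k}` of the real `x ≥ 0`, written as a two-sided
sequence: the greedy expansion of `x β^{-N} ∈ [0,1)`, moved `N` places to the left. -/
def IsBetaExpansion (β x : ℝ) (ε : ℤ → ℕ) : Prop :=
  ∃ N : ℕ, 0 ≤ x ∧ x < β ^ N ∧ (∀ n : ℕ, ε (n + 1 - N) = digit β (x / β ^ N) n) ∧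
    ∀ k : ℤ, k ≤ -N → ε k = 0

/-! ### The symbolic Pisot group -/

/-- The map `g`: to a class `a ∈ 𝒜_β` it assigns the set of all purely periodic two-sided sequences
in the compactum that extend the tail of the `β`-expansion of some nonnegative `ξ ∈ a`. -/
def symbolicClass (β : ℝ) (a : PisotGroup β) : Set (compactum β) :=
  {ε | (∃ d : ℕ, 0 < d ∧ ∀ k : ℤ, ε.1 (k + d) = ε.1 k) ∧
    ∃ ξ : pisotP β, (QuotientAddGroup.mk ξ : PisotGroup β) = a ∧ 0 ≤ (ξ : ℝ) ∧
      ∃ δ : ℤ → ℕ, IsBetaExpansion β ξ δ ∧ ∃ K : ℤ, ∀ k ≥ K, ε.1 k = δ k}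

/-- The symbolic Pisot group `𝔄_β`, the image of `g`; its elements are classes of sequences. -/
def symbolicPisotGroup (β : ℝ) : Set (Set (compactum β)) :=
  Set.range (symbolicClass β)

/-! ### The toral automorphism and the codings -/

/-- The torus `𝕋^m = ℝ^m / ℤ^m`. -/
abbrev Torus (β : ℝ) : Type := Fin (deg β) → UnitAddCircle

/-- The companion matrix of `x^m - k_1 x^{m-1} - … - k_m`, the minimal polynomial of `β`: first row
`k_1, …, k_m`, ones below the diagonal. -/
noncomputable def companion (β : ℝ) : Matrix (Fin (deg β)) (Fin (deg β)) ℤ :=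
  Matrix.of fun i j =>
    if (i : ℕ) = 0 then -(minpoly ℤ β).coeff (deg β - 1 - j)
    else if (i : ℕ) = j + 1 then 1 else 0

/-- The action of an integer matrix on the torus. -/
def toralMap {m : ℕ} (A : Matrix (Fin m) (Fin m) ℤ) (x : Fin m → UnitAddCircle) :
    Fin m → UnitAddCircle :=
  fun i => ∑ j, A i j • x j

/-- The point `(ξ, ξβ⁻¹, …, ξβ^{-m+1})` of the torus. -/
noncomputable def linePoint (β ξ : ℝ) : Torus β :=
  fun i => ((ξ * (β ^ (i : ℕ))⁻¹ : ℝ) : UnitAddCircle)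

/-- The term `ε_k T^{-k} t` with `t = (ξ, ξβ⁻¹, …, ξβ^{-m+1})`, where `T` is the automorphism given
by the companion matrix. -/
noncomputable def codingTerm (β ξ : ℝ) (ε : compactum β) (k : ℤ) : Torus β :=
  ε.1 k • toralMap (companion β ^ (-k)) (linePoint β ξ)

/-- The coding `ε ↦ ∑_{k ∈ ℤ} ε_k T^{-k} t` with `t = (ξ, ξβ⁻¹, …, ξβ^{-m+1})`. -/
noncomputable def coding (β ξ : ℝ) (ε : compactum β) : Torus β :=
  ∑' k : ℤ, codingTerm β ξ ε k

/-- `ξ₀ = 1 / g'(β)`, where `g` is the minimal polynomial of `β`. -/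
noncomputable def xiZero (β : ℝ) : ℝ := (aeval β (derivative (minpoly ℤ β)))⁻¹

/-- The coding `φ₀`, with `t₀ = (ξ₀, ξ₀β⁻¹, …, ξ₀β^{-m+1})`. -/
noncomputable def phiZero (β : ℝ) (ε : compactum β) : Torus β := coding β (xiZero β) ε

/-- The coding `φ`, with `t = (1, β⁻¹, …, β^{-m+1})`. -/
noncomputable def phi (β : ℝ) (ε : compactum β) : Torus β := coding β 1 ε

/-- The relation `ε ∼ ε'` iff `φ₀(ε) = φ₀(ε')`. -/
noncomputable def codingSetoid (β : ℝ) : Setoid (compactum β) := Setoid.ker (phiZero β)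

/-- The quotient `X'_β = X_β / ∼`. -/
noncomputable def QuotientCompactum (β : ℝ) : Type := Quotient (codingSetoid β)

/-- The class `[ε]` in `X'_β`. -/
noncomputable def toQuotient (β : ℝ) (ε : compactum β) : QuotientCompactum β :=
  Quotient.mk (codingSetoid β) ε

/-- An element of `X'_β` as a set of sequences. -/
noncomputable def classSet (β : ℝ) (x : QuotientCompactum β) : Set (compactum β) :=
  {ε | toQuotient β ε = x}

end PisotCoding

open PisotCoding

/-!
Write `t` and `t₀` for the points whose orbits define `φ` and `φ₀`. Since `t = g'(T) t₀`, we have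
`φ = g'(T) ∘ φ₀`, so `φ` descends to a homomorphism whose kernel is the finite group `ker g'(T)`.

Lift the coding to `ℝ^m`, so that `φ₀` is the projection of a real series. Let `ν` be the linear
functional with `ν ∘ T = β ν`. It carries `ℤ^m` isomorphically onto `ℤ[β]`, and `g'(T)⁻¹ ℤ^m` onto
`g'(β)⁻¹ ℤ[β]`, which is `𝒫_β`; hence `𝒜_β ≅ ker g'(T)`.

If `φ₀ ε` lies in the finite kernel, the lifts of the shifted sequences stay in a bounded part of
the lattice `g'(T)⁻¹ ℤ^m`. Only finitely many tails of `ε` occur, so `ε` is periodic, and its tail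
is the greedy expansion of a value of `ν` on that lattice. Conversely, let a periodic `ε` have the
same tail as the expansion of `ξ ∈ a`. Under `T^p` the difference between `φ₀ ε` and the point of
`a` tends to `0` while running through a finite set, so it vanishes.

The map `φ₀` is onto because the unstable line is dense in the torus and the admissible sequences
that vanish far to the left have codes filling it; compactness of the weakly admissible sequences
gives every point a code, and carrying turns that code into an admissible one.
-/

namespace PisotCoding

variable {β : ℝ}

/-! ### The companion matrix and its eigenvectors -/

namespace IsPisotUnit

lemma pos (hβ : IsPisotUnit β) : 0 < β := zero_lt_one.trans hβ.one_lt

lemma ne_zero (hβ : IsPisotUnit β) : β ≠ 0 := hβ.pos.ne'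

lemma monic (hβ : IsPisotUnit β) : (minpoly ℤ β).Monic := minpoly.monic hβ.isIntegral

lemma deg_pos (hβ : IsPisotUnit β) : 0 < deg β := minpoly.natDegree_pos hβ.isIntegral

lemma map_minpoly (hβ : IsPisotUnit β) :
    (minpoly ℤ β).map (algebraMap ℤ ℚ) = minpoly ℚ β :=
  (minpoly.isIntegrallyClosed_eq_field_fractions' ℚ hβ.isIntegral).symm

lemma separable (hβ : IsPisotUnit β) : (minpoly ℚ β).Separable :=
  (minpoly.irreducible hβ.isIntegral.tower_top).separable

lemma ne_zero_of_root (hβ : IsPisotUnit β) {K : Type*} [Field K] [CharZero K] {x : K}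
    (hx : aeval x (minpoly ℤ β) = 0) : x ≠ 0 := by
  rintro rfl
  rw [← coeff_zero_eq_aeval_zero'] at hx
  exact hβ.unit.ne_zero ((algebraMap ℤ K).injective_int (by simpa using hx))

end IsPisotUnit

/-- The action of an integer matrix on `R^m`, as a homomorphism into the linear endomorphisms. -/
def matAct (R : Type*) [CommRing R] {m : ℕ} :
    Matrix (Fin m) (Fin m) ℤ →ₐ[ℤ] Module.End R (Fin m → R) :=
  ((Matrix.toLinAlgEquiv' : Matrix (Fin m) (Fin m) R ≃ₐ[R] _).toRingHom.comp
    (Int.castRingHom R).mapMatrix).toIntAlgHom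

lemma matAct_apply {R : Type*} [CommRing R] {m : ℕ} (A : Matrix (Fin m) (Fin m) ℤ) (v : Fin m → R)
    (i : Fin m) : matAct R A v i = ∑ j, (A i j : R) * v j := rfl

lemma matAct_injective {R : Type*} [CommRing R] [CharZero R] {m : ℕ} :
    Function.Injective (matAct R (m := m)) :=
  (Matrix.toLinAlgEquiv' : Matrix (Fin m) (Fin m) R ≃ₐ[R] _).injective.comp
    (Matrix.map_injective Int.cast_injective)

lemma matAct_comp {R S : Type*} [CommRing R] [CommRing S] (f : R →+* S) {m : ℕ}
    (A : Matrix (Fin m) (Fin m) ℤ) (v : Fin m → R) : matAct S A (f ∘ v) = f ∘ matAct R A v := by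
  funext i
  simp [matAct_apply]

lemma aeval_matAct {R : Type*} [CommRing R] {m : ℕ} (A : Matrix (Fin m) (Fin m) ℤ) (p : ℤ[X]) :
    aeval (matAct R A) p = matAct R (aeval A p) := aeval_algHom_apply _ _ _

/-- The vector `(1, x⁻¹, …, x^{-m+1})`, an eigenvector of the companion matrix when `x` is a
conjugate of `β`. -/
def lineVec (β : ℝ) {K : Type*} [Field K] (x : K) : Fin (deg β) → K := fun i => (x ^ (i : ℕ))⁻¹

section Field

variable {K : Type*} [Field K] [CharZero K] {x : K}

lemma sum_coeff_mul_lineVec (hβ : IsPisotUnit β) (hx : aeval x (minpoly ℤ β) = 0) :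
    ∑ j : Fin (deg β), ((minpoly ℤ β).coeff (deg β - 1 - j) : K) * lineVec β x j = -x := by
  have hx0 := hβ.ne_zero_of_root hx
  have hpow : x ^ (deg β - 1) * x = x ^ deg β := pow_sub_one_mul hβ.deg_pos.ne' x
  have hsum : ∑ n ∈ Finset.range (deg β), ((minpoly ℤ β).coeff n : K) * x ^ n = -x ^ deg β := by
    rw [aeval_eq_sum_range, Finset.sum_range_succ, add_eq_zero_iff_eq_neg, coeff_natDegree,
      hβ.monic.leadingCoeff, one_smul] at hx
    simp only [zsmul_eq_mul] at hx
    exact hx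
  refine mul_left_cancel₀ (pow_ne_zero (deg β - 1) hx0) ?_
  rw [mul_neg, hpow, ← hsum, ← Finset.sum_range_reflect, ← Fin.sum_univ_eq_sum_range
    (fun j => ((minpoly ℤ β).coeff (deg β - 1 - j) : K) * x ^ (deg β - 1 - j)), Finset.mul_sum]
  refine Finset.sum_congr rfl fun j _ => ?_
  rw [lineVec, pow_sub₀ x hx0 (by omega : (j : ℕ) ≤ deg β - 1)]
  ring

lemma companion_lineVec (hβ : IsPisotUnit β) (hx : aeval x (minpoly ℤ β) = 0) :
    matAct K (companion β) (lineVec β x) = x • lineVec β x := by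
  have hx0 := hβ.ne_zero_of_root hx
  funext ⟨i, hi⟩
  rw [matAct_apply, Pi.smul_apply, smul_eq_mul]
  rcases i with - | i
  · have h := congrArg Neg.neg (sum_coeff_mul_lineVec hβ hx)
    simpa [companion, lineVec] using h
  · rw [Finset.sum_eq_single ⟨i, by omega⟩]
    · simp [companion, lineVec, pow_succ, hx0]
    · intro j _ hj
      have : i ≠ (j : ℕ) := fun h => hj (Fin.ext h.symm)
      simp [companion, this]
    · simp

end Field

/-- The conjugates of `β` in `ℂ`. -/
abbrev Conjugate (β : ℝ) : Type := (minpoly ℚ β).rootSet ℂ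

lemma Conjugate.aeval_eq_zero (hβ : IsPisotUnit β) (α : Conjugate β) :
    aeval (α : ℂ) (minpoly ℤ β) = 0 := by
  rw [← aeval_map_algebraMap ℚ, hβ.map_minpoly]
  exact (mem_rootSet.1 α.2).2

lemma span_lineVec_eq_top (hβ : IsPisotUnit β) :
    Submodule.span ℂ (Set.range fun α : Conjugate β => lineVec β (α : ℂ)) = ⊤ := by
  have hind : LinearIndependent ℂ fun α : Conjugate β => lineVec β (α : ℂ) :=
    Module.End.eigenvectors_linearIndependent' (matAct ℂ (companion β))
      (fun α : Conjugate β => (α : ℂ)) Subtype.val_injective _ fun α =>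
        ⟨Module.End.mem_eigenspace_iff.2 (companion_lineVec hβ (Conjugate.aeval_eq_zero hβ α)),
          fun h => by simpa [lineVec] using congrFun h ⟨0, hβ.deg_pos⟩⟩
  refine hind.span_eq_top_of_card_eq_finrank' ?_
  rw [card_rootSet_eq_natDegree hβ.separable (IsAlgClosed.splits _), ← hβ.map_minpoly,
    hβ.monic.natDegree_map, Module.finrank_fin_fun]
  rfl

lemma map_aeval_apply_of_semiconj {R V W : Type*} [CommRing R] [AddCommGroup V] [Module R V]
    [AddCommGroup W] [Module R W] {L : V →ₗ[R] W} {f : Module.End R V} {b : R}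
    (h : ∀ v, L (f v) = b • L v) (p : ℤ[X]) (v : V) : L (aeval f p v) = aeval b p • L v := by
  induction p using Polynomial.induction_on generalizing v with
  | C a => simp [Int.cast_smul_eq_zsmul]
  | add p q hp hq => simp only [map_add, LinearMap.add_apply, hp, hq, add_smul]
  | monomial n a ih =>
    rw [pow_succ, ← mul_assoc, map_mul, aeval_X, Module.End.mul_apply, ih, h,
      map_mul (f := aeval b) _ X, aeval_X, mul_smul]

lemma aeval_apply_of_eigenvector {R V : Type*} [CommRing R] [AddCommGroup V] [Module R V]
    {f : Module.End R V} {b : R} {v : V} (h : f v = b • v) (p : ℤ[X]) :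
    aeval f p v = aeval b p • v := by
  induction p using Polynomial.induction_on with
  | C a => simp [Int.cast_smul_eq_zsmul]
  | add p q hp hq => simp only [map_add, LinearMap.add_apply, hp, hq, add_smul]
  | monomial n a ih =>
    rw [pow_succ, ← mul_assoc, map_mul, aeval_X, Module.End.mul_apply, h, map_smul, ih,
      map_mul (f := aeval b) _ X, aeval_X, mul_comm _ b, mul_smul]

lemma aeval_companion (hβ : IsPisotUnit β) : aeval (companion β) (minpoly ℤ β) = 0 := by
  refine matAct_injective (R := ℂ) ?_
  rw [map_zero, ← aeval_matAct]
  refine LinearMap.ext_on_range (span_lineVec_eq_top hβ) fun α => ?_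
  have hα := Conjugate.aeval_eq_zero hβ α
  rw [aeval_apply_of_eigenvector (companion_lineVec hβ hα), hα, zero_smul, LinearMap.zero_apply]

lemma isUnit_det_companion (hβ : IsPisotUnit β) : IsUnit (companion β).det := by
  have h := aeval_companion hβ
  rw [← divX_mul_X_add (minpoly ℤ β), map_add, map_mul, aeval_X, aeval_C,
    add_eq_zero_iff_eq_neg] at h
  refine (Matrix.isUnit_iff_isUnit_det _).1 (isUnit_of_mul_isUnit_right
    (x := aeval (companion β) (minpoly ℤ β).divX) ?_)
  rw [h]
  exact (hβ.unit.map _).neg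

/-- The integer matrix `g'(T)`, where `g` is the minimal polynomial of `β` and `T` its companion
matrix. -/
noncomputable def derivMat (β : ℝ) : Matrix (Fin (deg β)) (Fin (deg β)) ℤ :=
  aeval (companion β) (derivative (minpoly ℤ β))

lemma det_derivMat_ne_zero (hβ : IsPisotUnit β) : (derivMat β).det ≠ 0 := by
  intro hdet
  obtain ⟨z, hz0, hz⟩ := Matrix.exists_mulVec_eq_zero_iff.2 hdet
  obtain ⟨a, b, hab⟩ := hβ.separable
  have hinv : aeval (matAct ℚ (companion β)) b * matAct ℚ (derivMat β) = 1 := by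
    have h := congrArg (aeval (matAct ℚ (companion β))) hab
    rwa [← hβ.map_minpoly, derivative_map, map_add, map_mul, map_mul, aeval_map_algebraMap,
      aeval_map_algebraMap, aeval_matAct, aeval_matAct, aeval_companion hβ, map_zero, mul_zero,
      zero_add, map_one] at h
  have hker : matAct ℚ (derivMat β) (Int.castRingHom ℚ ∘ z) = 0 := by
    rw [matAct_comp, show matAct ℤ (derivMat β) z = 0 from hz]
    exact funext fun _ => Int.cast_zero
  have hcast := LinearMap.congr_fun hinv (Int.castRingHom ℚ ∘ z)
  rw [Module.End.mul_apply, hker, map_zero] at hcast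
  exact hz0 (funext fun i => by simpa using (congrFun hcast i).symm)

/-! ### The unstable functional -/

lemma eq_zpow_smul_of_forall_add_one {K V : Type*} [DivisionRing K] [AddCommGroup V] [Module K V]
    {b : K} (hb : b ≠ 0) {f : ℤ → V} (h : ∀ k, f (k + 1) = b • f k) (k : ℤ) :
    f k = b ^ k • f 0 := by
  induction k with
  | zero => simp
  | succ n ih => rw [h, ih, smul_smul, ← zpow_one_add₀ hb, add_comm]
  | pred n ih =>
    refine smul_right_injective V hb ?_
    change b • _ = b • _
    rw [← h, sub_add_cancel, ih, smul_smul, ← zpow_one_add₀ hb, add_sub_cancel]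

lemma matAct_zpow_add (hβ : IsPisotUnit β) (j k : ℤ) (v : Fin (deg β) → ℝ) :
    matAct ℝ (companion β ^ (j + k)) v =
      matAct ℝ (companion β ^ j) (matAct ℝ (companion β ^ k) v) := by
  rw [Matrix.zpow_add (isUnit_det_companion hβ), map_mul, Module.End.mul_apply]

lemma companion_zpow_lineVec (hβ : IsPisotUnit β) (k : ℤ) :
    matAct ℝ (companion β ^ k) (lineVec β β) = β ^ k • lineVec β β := by
  have h := eq_zpow_smul_of_forall_add_one (f := fun k => matAct ℝ (companion β ^ k) (lineVec β β))
    hβ.ne_zero (fun k => by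
      rw [matAct_zpow_add hβ, zpow_one, companion_lineVec hβ (minpoly.aeval ℤ β), map_smul]) k
  simpa using h

/-- The number `g'(β)`, where `g` is the minimal polynomial of `β`. -/
noncomputable def derivAt (β : ℝ) : ℝ := aeval β (derivative (minpoly ℤ β))

/-- The cofactor `g(x) / (x - β)` of the minimal polynomial `g` of `β`. -/
noncomputable def cofactor (β : ℝ) : ℝ[X] := (minpoly ℤ β).map (Int.castRingHom ℝ) /ₘ (X - C β)

lemma mul_cofactor (β : ℝ) :
    (X - C β) * cofactor β = (minpoly ℤ β).map (Int.castRingHom ℝ) :=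
  mul_divByMonic_eq_iff_isRoot.2 <| by
    rw [IsRoot, eval_map]
    exact minpoly.aeval ℤ β

lemma eval_cofactor (β : ℝ) : (cofactor β).eval β = derivAt β := by
  have h := congrArg (fun p => (derivative p).eval β) (mul_cofactor β)
  simp only [derivative_mul, derivative_sub, derivative_X, derivative_C, derivative_map] at h
  rw [derivAt, aeval_def, ← eval_map]
  simpa using h

lemma derivAt_ne_zero (hβ : IsPisotUnit β) : derivAt β ≠ 0 := by
  have h := hβ.separable.eval₂_derivative_ne_zero (algebraMap ℚ ℝ) (minpoly.aeval ℚ β)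
  rwa [← hβ.map_minpoly, derivative_map, eval₂_map] at h

lemma natDegree_cofactor (hβ : IsPisotUnit β) : (cofactor β).natDegree = deg β - 1 := by
  rw [cofactor, natDegree_divByMonic _ (monic_X_sub_C β), natDegree_X_sub_C,
    hβ.monic.natDegree_map, deg]

lemma monic_cofactor (hβ : IsPisotUnit β) : (cofactor β).Monic :=
  (monic_X_sub_C β).of_mul_monic_left (by rw [mul_cofactor]; exact hβ.monic.map _)

lemma coeff_cofactor_mem (β : ℝ) (n : ℕ) : (cofactor β).coeff n ∈ ringZ β := by
  change _ ∈ Algebra.adjoin ℤ {β}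
  rw [cofactor, coeff_divByMonic_X_sub_C]
  refine sum_mem fun i _ => mul_mem (pow_mem (Algebra.self_mem_adjoin_singleton ℤ β) _) ?_
  rw [coeff_map]
  exact intCast_mem _ _

/-- The coordinates of the left eigenvector of the companion matrix for the eigenvalue `β`. They are
the coefficients of the cofactor in decreasing order; with the factor `β^{m-1}` the pairing with
`(1, β⁻¹, …, β^{-m+1})` is `g'(β)`. -/
noncomputable def unstableWeight (β : ℝ) (j : Fin (deg β)) : ℝ :=
  β ^ (deg β - 1) * (cofactor β).coeff (deg β - 1 - j)

lemma sum_unstableWeight_mul_companion (hβ : IsPisotUnit β) (j : Fin (deg β)) :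
    ∑ i, unstableWeight β i * companion β i j = β * unstableWeight β j := by
  have hd := hβ.deg_pos
  have hsplit : ∀ i : Fin (deg β), (companion β i j : ℝ) =
      (if i = ⟨0, hd⟩ then -((minpoly ℤ β).coeff (deg β - 1 - j) : ℝ) else 0) +
        if (i : ℕ) = j + 1 then 1 else 0 := by
    intro i
    by_cases hi : (i : ℕ) = 0 <;> simp [companion, hi, Fin.ext_iff]
  have hlead : (cofactor β).coeff (deg β - 1) = 1 := by
    rw [← natDegree_cofactor hβ, coeff_natDegree, monic_cofactor hβ]
  have hcoeff : ((minpoly ℤ β).coeff (deg β - 1 - j) : ℝ) =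
      ((X - C β) * cofactor β).coeff (deg β - 1 - j) := by
    rw [mul_cofactor, coeff_map, eq_intCast]
  simp only [hsplit, mul_add, Finset.sum_add_distrib, mul_ite, mul_zero, Finset.sum_ite_eq',
    Finset.mem_univ, if_true, unstableWeight, mul_one, hcoeff]
  rcases lt_or_ge ((j : ℕ) + 1) (deg β) with hj | hj
  · obtain ⟨n, hn⟩ := Nat.exists_eq_add_of_lt hj
    rw [Finset.sum_eq_single ⟨j + 1, hj⟩ (fun i _ hi => if_neg fun h => hi (Fin.ext h)) (by simp),
      if_pos rfl, show deg β - 1 - j = n + 1 by omega, coeff_X_sub_C_mul, Nat.sub_zero, hlead,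
      show deg β - 1 - (j + 1) = n by omega]
    ring
  · rw [Finset.sum_eq_zero fun i _ => if_neg (by omega), show deg β - 1 - (j : ℕ) = 0 by omega,
      mul_coeff_zero, Nat.sub_zero, hlead]
    simp
    ring

lemma sum_unstableWeight_mul_matAct {K : Type*} [CommRing K] [Algebra ℝ K] (hβ : IsPisotUnit β)
    (v : Fin (deg β) → K) :
    ∑ i, unstableWeight β i • matAct K (companion β) v i = β • ∑ i, unstableWeight β i • v i := by
  simp only [matAct_apply, Finset.smul_sum]
  rw [Finset.sum_comm]
  refine Finset.sum_congr rfl fun j _ => ?_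
  rw [smul_smul, ← sum_unstableWeight_mul_companion hβ j, Finset.sum_smul]
  refine Finset.sum_congr rfl fun i _ => ?_
  rw [mul_smul, Int.cast_smul_eq_zsmul, zsmul_eq_mul]

/-- The functional `ν` on `ℝ^m` with `ν ∘ T = β ν`, whose kernel is the stable space of the
companion matrix `T`. -/
noncomputable def unstable (β : ℝ) : (Fin (deg β) → ℝ) →ₗ[ℝ] ℝ :=
  ∑ i, unstableWeight β i • LinearMap.proj i

lemma unstable_apply (v : Fin (deg β) → ℝ) :
    unstable β v = ∑ i, unstableWeight β i • v i := by
  simp [unstable]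

lemma unstable_companion (hβ : IsPisotUnit β) (v : Fin (deg β) → ℝ) :
    unstable β (matAct ℝ (companion β) v) = β • unstable β v := by
  rw [unstable_apply, unstable_apply, sum_unstableWeight_mul_matAct hβ]

lemma unstable_zpow (hβ : IsPisotUnit β) (k : ℤ) (v : Fin (deg β) → ℝ) :
    unstable β (matAct ℝ (companion β ^ k) v) = β ^ k * unstable β v := by
  have h := eq_zpow_smul_of_forall_add_one
    (f := fun k => unstable β (matAct ℝ (companion β ^ k) v)) hβ.ne_zero (fun k => by
      rw [add_comm, matAct_zpow_add hβ, zpow_one, unstable_companion hβ]) k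
  simpa using h

lemma unstable_lineVec (hβ : IsPisotUnit β) : unstable β (lineVec β β) = derivAt β := by
  rw [unstable_apply, ← eval_cofactor, eval_eq_sum_range, natDegree_cofactor hβ,
    Nat.sub_add_cancel hβ.deg_pos, ← Finset.sum_range_reflect, ← Fin.sum_univ_eq_sum_range
      (fun j => (cofactor β).coeff (deg β - 1 - j) * β ^ (deg β - 1 - j))]
  refine Finset.sum_congr rfl fun j _ => ?_
  rw [unstableWeight, lineVec, pow_sub₀ β hβ.ne_zero (by omega : (j : ℕ) ≤ deg β - 1), smul_eq_mul]
  ring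

/-- The point `(ξ₀, ξ₀β⁻¹, …, ξ₀β^{-m+1})` of `ℝ^m`. -/
noncomputable def baseVec (β : ℝ) : Fin (deg β) → ℝ := xiZero β • lineVec β β

lemma unstable_baseVec (hβ : IsPisotUnit β) : unstable β (baseVec β) = 1 := by
  rw [baseVec, map_smul, unstable_lineVec hβ]
  exact inv_mul_cancel₀ (derivAt_ne_zero hβ)

lemma companion_zpow_baseVec (hβ : IsPisotUnit β) (k : ℤ) :
    matAct ℝ (companion β ^ k) (baseVec β) = β ^ k • baseVec β := by
  rw [baseVec, map_smul, companion_zpow_lineVec hβ, smul_comm]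

/-! ### Contraction on the stable space -/

lemma exists_norm_conjugate_le (hβ : IsPisotUnit β) : ∃ ρ : ℝ, 0 < ρ ∧ ρ < 1 ∧
    ∀ α : Conjugate β, (α : ℂ) ≠ β → ‖(α : ℂ)‖ ≤ ρ := by
  have h : ∀ᶠ ρ in 𝓝[<] (1 : ℝ), ∀ α : Conjugate β, (α : ℂ) ≠ β → ‖(α : ℂ)‖ ≤ ρ := by
    simp only [eventually_all]
    intro α hα
    exact mem_of_superset
      (Ioo_mem_nhdsLT (hβ.conj_lt α (Conjugate.aeval_eq_zero hβ α) hα)) fun ρ hρ => hρ.1.le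
  obtain ⟨ρ, hρ, h0, h1⟩ := (h.and (Ioo_mem_nhdsLT zero_lt_one)).exists
  exact ⟨ρ, h0, h1, hρ⟩

lemma sum_unstableWeight_mul_lineVec_eq_zero (hβ : IsPisotUnit β) (α : Conjugate β)
    (hα : (α : ℂ) ≠ β) : ∑ i, unstableWeight β i • lineVec β (α : ℂ) i = 0 := by
  have h := sum_unstableWeight_mul_matAct hβ (lineVec β (α : ℂ))
  rw [companion_lineVec hβ (Conjugate.aeval_eq_zero hβ α)] at h
  simp only [Pi.smul_apply, smul_comm _ (α : ℂ), ← Finset.smul_sum] at h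
  rw [← sub_eq_zero, Complex.real_smul, smul_eq_mul, ← sub_mul] at h
  exact (mul_eq_zero.1 h).resolve_left (sub_ne_zero.2 hα)

lemma exists_sum_smul_lineVec (hβ : IsPisotUnit β) {v : Fin (deg β) → ℝ} (hv : unstable β v = 0) :
    ∃ c : Conjugate β → ℂ, (∀ α : Conjugate β, (α : ℂ) = β → c α = 0) ∧
      ∑ α, c α • lineVec β (α : ℂ) = Complex.ofRealHom ∘ v := by
  have hmem : Complex.ofRealHom ∘ v ∈
      Submodule.span ℂ (Set.range fun α : Conjugate β => lineVec β (α : ℂ)) := by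
    rw [span_lineVec_eq_top hβ]
    trivial
  obtain ⟨c, hc⟩ := (Submodule.mem_span_range_iff_exists_fun ℂ).1 hmem
  refine ⟨c, fun α hα => ?_, hc⟩
  have hline : ∑ i, unstableWeight β i • lineVec β (α : ℂ) i = derivAt β := by
    rw [← unstable_lineVec hβ, unstable_apply, hα]
    simp [lineVec]
  have hzero : ∑ i, unstableWeight β i • (Complex.ofRealHom ∘ v) i = 0 := by
    rw [unstable_apply] at hv
    simpa using congrArg Complex.ofReal hv
  have hsum : c α * derivAt β = 0 := by
    rw [← hzero, ← hc, ← hline]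
    simp only [Finset.sum_apply, Finset.smul_sum]
    rw [Finset.sum_comm, Finset.sum_eq_single α]
    · simp only [Finset.mul_sum, Pi.smul_apply, smul_eq_mul, mul_smul_comm]
    · intro α' _ hne
      have h := sum_unstableWeight_mul_lineVec_eq_zero hβ α'
        fun h => hne (Subtype.ext (h.trans hα.symm))
      simp only [Pi.smul_apply, smul_comm _ (c α'), ← Finset.smul_sum, h, smul_zero]
    · simp
  exact (mul_eq_zero.1 hsum).resolve_right (by exact_mod_cast derivAt_ne_zero hβ)

lemma norm_ofReal_comp {m : ℕ} (v : Fin m → ℝ) : ‖Complex.ofRealHom ∘ v‖ = ‖v‖ := by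
  simp [Pi.norm_def]

lemma companion_pow_lineVec {K : Type*} [Field K] [CharZero K] {x : K} (hβ : IsPisotUnit β)
    (hx : aeval x (minpoly ℤ β) = 0) (n : ℕ) :
    matAct K (companion β ^ n) (lineVec β x) = x ^ n • lineVec β x := by
  simpa [aeval_matAct] using aeval_apply_of_eigenvector (companion_lineVec hβ hx) (X ^ n)

lemma exists_rate (hβ : IsPisotUnit β) : ∃ ρ : ℝ, 0 < ρ ∧ ρ < 1 ∧
    ∀ v, unstable β v = 0 → ∃ D : ℝ, ∀ n : ℕ, ‖matAct ℝ (companion β ^ n) v‖ ≤ D * ρ ^ n := by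
  obtain ⟨ρ, h0, h1, hρ⟩ := exists_norm_conjugate_le hβ
  refine ⟨ρ, h0, h1, fun v hv => ?_⟩
  obtain ⟨c, hcβ, hc⟩ := exists_sum_smul_lineVec hβ hv
  refine ⟨∑ α, ‖c α‖ * ‖lineVec β (α : ℂ)‖, fun n => ?_⟩
  rw [← norm_ofReal_comp, ← matAct_comp, ← hc, map_sum, Finset.sum_mul]
  refine (norm_sum_le _ _).trans (Finset.sum_le_sum fun α _ => ?_)
  rw [map_smul, companion_pow_lineVec hβ (Conjugate.aeval_eq_zero hβ α), norm_smul, norm_smul,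
    norm_pow, mul_right_comm, ← mul_assoc]
  by_cases hα : (α : ℂ) = β
  · simp [hcβ α hα]
  · have := hρ α hα
    gcongr

lemma tendsto_companion_pow_of_unstable_eq_zero (hβ : IsPisotUnit β) {v : Fin (deg β) → ℝ}
    (hv : unstable β v = 0) :
    Tendsto (fun n : ℕ => matAct ℝ (companion β ^ n) v) atTop (𝓝 0) := by
  obtain ⟨ρ, h0, h1, hrate⟩ := exists_rate hβ
  obtain ⟨D, hD⟩ := hrate v hv
  refine squeeze_zero_norm hD ?_
  simpa using (tendsto_pow_atTop_nhds_zero_of_lt_one h0.le h1).const_mul D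

/-- The projection of `ℝ^m` to the stable space along the unstable line. -/
noncomputable def stab (β : ℝ) : (Fin (deg β) → ℝ) →ₗ[ℝ] (Fin (deg β) → ℝ) :=
  LinearMap.id - (unstable β).smulRight (baseVec β)

lemma stab_apply (v : Fin (deg β) → ℝ) : stab β v = v - unstable β v • baseVec β := rfl

lemma unstable_stab (hβ : IsPisotUnit β) (v : Fin (deg β) → ℝ) : unstable β (stab β v) = 0 := by
  rw [stab_apply, map_sub, map_smul, unstable_baseVec hβ, smul_eq_mul, mul_one, sub_self]

lemma exists_contraction (hβ : IsPisotUnit β) : ∃ ρ D : ℝ, 0 < ρ ∧ ρ < 1 ∧ 0 ≤ D ∧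
    ∀ v (n : ℕ), ‖matAct ℝ (companion β ^ n) (stab β v)‖ ≤ D * ρ ^ n * ‖v‖ := by
  obtain ⟨ρ, h0, h1, hrate⟩ := exists_rate hβ
  choose D hD using fun i : Fin (deg β) => hrate (stab β (Pi.single i 1)) (unstable_stab hβ _)
  have hD0 : ∀ i, 0 ≤ D i := fun i => by simpa using (norm_nonneg _).trans (hD i 0)
  refine ⟨ρ, ∑ i, D i, h0, h1, Finset.sum_nonneg fun i _ => hD0 i, fun v n => ?_⟩
  conv_lhs => rw [pi_eq_sum_univ' v]
  rw [map_sum, map_sum, Finset.sum_mul, Finset.sum_mul]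
  refine (norm_sum_le _ _).trans (Finset.sum_le_sum fun i _ => ?_)
  rw [map_smul, map_smul, norm_smul, mul_comm]
  gcongr
  · exact mul_nonneg (hD0 i) (by positivity)
  · exact hD i n
  · exact norm_le_pi_norm v i

/-! ### Integer vectors and the torus -/

/-- The inclusion `ℤ^m → ℝ^m`. -/
def intVec {m : ℕ} : (Fin m → ℤ) →+ (Fin m → ℝ) := (Int.castAddHom ℝ).compLeft _

lemma intVec_apply {m : ℕ} (z : Fin m → ℤ) (i : Fin m) : intVec z i = z i := rfl

lemma matAct_intVec {m : ℕ} (A : Matrix (Fin m) (Fin m) ℤ) (z : Fin m → ℤ) :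
    matAct ℝ A (intVec z) = intVec (A.mulVec z) := matAct_comp (Int.castRingHom ℝ) A z

lemma unstable_intVec_mem (z : Fin (deg β) → ℤ) : unstable β (intVec z) ∈ ringZ β := by
  change _ ∈ Algebra.adjoin ℤ {β}
  rw [unstable_apply]
  refine sum_mem fun i _ => mul_mem (mul_mem ?_ (coeff_cofactor_mem β _)) (intCast_mem _ _)
  exact pow_mem (Algebra.self_mem_adjoin_singleton ℤ β) _

/-- An integer vector on which the unstable functional takes the value `1`. -/
noncomputable def unitVec (β : ℝ) : Fin (deg β) → ℤ :=
  (companion β ^ (-(deg β - 1 : ℕ) : ℤ)).mulVec fun i => if (i : ℕ) = 0 then 1 else 0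

lemma unstable_unitVec (hβ : IsPisotUnit β) : unstable β (intVec (unitVec β)) = 1 := by
  have hlead : (cofactor β).coeff (deg β - 1) = 1 := by
    rw [← natDegree_cofactor hβ, coeff_natDegree, monic_cofactor hβ]
  have hsum : unstable β (intVec fun i => if (i : ℕ) = 0 then 1 else 0) = β ^ (deg β - 1) := by
    rw [unstable_apply, Finset.sum_eq_single ⟨0, hβ.deg_pos⟩]
    · simp [unstableWeight, intVec_apply, hlead]
    · intro i _ hi
      simp [intVec_apply, show (i : ℕ) ≠ 0 from fun h => hi (Fin.ext h)]
    · simp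
  rw [unitVec, ← matAct_intVec, unstable_zpow hβ, hsum, zpow_neg, zpow_natCast,
    inv_mul_cancel₀ (pow_ne_zero _ hβ.ne_zero)]

lemma unstable_aeval_companion (hβ : IsPisotUnit β) (p : ℤ[X]) (v : Fin (deg β) → ℝ) :
    unstable β (matAct ℝ (aeval (companion β) p) v) = aeval β p * unstable β v := by
  rw [← aeval_matAct, map_aeval_apply_of_semiconj (unstable_companion hβ), smul_eq_mul]

lemma exists_unstable_intVec_eq (hβ : IsPisotUnit β) {x : ℝ} (hx : x ∈ ringZ β) :
    ∃ z, unstable β (intVec z) = x := by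
  obtain ⟨p, rfl⟩ : x ∈ (aeval β : ℤ[X] →ₐ[ℤ] ℝ).range := by
    rwa [← Algebra.adjoin_singleton_eq_range_aeval]
  exact ⟨(aeval (companion β) p).mulVec (unitVec β), by
    rw [← matAct_intVec, unstable_aeval_companion hβ, unstable_unitVec hβ, mul_one]; rfl⟩

lemma eq_zero_of_norm_intVec_lt_one {m : ℕ} {z : Fin m → ℤ} (h : ‖intVec z‖ < 1) : z = 0 := by
  funext i
  have hi := (norm_le_pi_norm (intVec z) i).trans_lt h
  rw [intVec_apply, Real.norm_eq_abs] at hi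
  exact Int.abs_lt_one_iff.1 (by exact_mod_cast hi)

lemma eq_zero_of_unstable_intVec (hβ : IsPisotUnit β) {z : Fin (deg β) → ℤ}
    (hz : unstable β (intVec z) = 0) : z = 0 := by
  have h := (tendsto_companion_pow_of_unstable_eq_zero hβ hz).norm
  rw [norm_zero] at h
  obtain ⟨n, hn⟩ := (h.eventually (gt_mem_nhds one_pos)).exists
  rw [matAct_intVec] at hn
  have hdet : IsUnit (companion β ^ n) :=
    ((Matrix.isUnit_iff_isUnit_det _).2 (isUnit_det_companion hβ)).pow n
  exact Matrix.mulVec_injective_of_isUnit hdet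
    ((eq_zero_of_norm_intVec_lt_one hn).trans (Matrix.mulVec_zero _).symm)

/-- The projection `ℝ^m → 𝕋^m`. -/
def torusMk {m : ℕ} : (Fin m → ℝ) →+ (Fin m → UnitAddCircle) :=
  (QuotientAddGroup.mk' (AddSubgroup.zmultiples (1 : ℝ))).compLeft _

lemma torusMk_apply {m : ℕ} (v : Fin m → ℝ) (i : Fin m) : torusMk v i = (v i : UnitAddCircle) := rfl

lemma continuous_torusMk {m : ℕ} :
    Continuous (torusMk : (Fin m → ℝ) → (Fin m → UnitAddCircle)) :=
  continuous_pi fun i => (AddCircle.continuous_mk' (1 : ℝ)).comp (continuous_apply i)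

lemma torusMk_surjective {m : ℕ} :
    Function.Surjective (torusMk : (Fin m → ℝ) → (Fin m → UnitAddCircle)) :=
  QuotientAddGroup.mk_surjective.comp_left

lemma torusMk_eq_zero_iff {m : ℕ} {v : Fin m → ℝ} : torusMk v = 0 ↔ ∃ z, v = intVec z := by
  simp only [funext_iff, torusMk_apply, Pi.zero_apply, AddCircle.coe_eq_zero_iff, zsmul_one,
    intVec_apply, Classical.skolem, @eq_comm ℝ (v _)]

lemma torusMk_intVec {m : ℕ} (z : Fin m → ℤ) : torusMk (intVec z) = 0 :=
  torusMk_eq_zero_iff.2 ⟨z, rfl⟩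

/-- The representative of `v` modulo `ℤ^m` with coordinates of least modulus. -/
noncomputable def reduce {m : ℕ} (v : Fin m → ℝ) : Fin m → ℝ := v - intVec (round ∘ v)

lemma torusMk_reduce {m : ℕ} (v : Fin m → ℝ) : torusMk (reduce v) = torusMk v := by
  rw [reduce, map_sub, torusMk_intVec, sub_zero]

lemma norm_torusMk {m : ℕ} (v : Fin m → ℝ) : ‖torusMk v‖ = ‖reduce v‖ := by
  simp only [reduce, Pi.norm_def, torusMk_apply, Pi.sub_apply, intVec_apply, Function.comp_apply]
  congr 3
  funext i
  exact NNReal.eq (UnitAddCircle.norm_eq.trans (Real.norm_eq_abs _).symm)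

lemma toralMap_torusMk {m : ℕ} (A : Matrix (Fin m) (Fin m) ℤ) (v : Fin m → ℝ) :
    toralMap A (torusMk v) = torusMk (matAct ℝ A v) := by
  funext i
  rw [torusMk_apply, matAct_apply]
  refine Eq.trans ?_ (map_sum (QuotientAddGroup.mk' (AddSubgroup.zmultiples (1 : ℝ)))
    (fun j => (A i j : ℝ) * v j) Finset.univ).symm
  simp only [← zsmul_eq_mul]
  rfl

lemma toralMap_mul {m : ℕ} (A B : Matrix (Fin m) (Fin m) ℤ) (x : Fin m → UnitAddCircle) :
    toralMap (A * B) x = toralMap A (toralMap B x) := by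
  obtain ⟨v, rfl⟩ := torusMk_surjective x
  simp only [toralMap_torusMk, map_mul, Module.End.mul_apply]

lemma toralMap_one {m : ℕ} (x : Fin m → UnitAddCircle) :
    toralMap (1 : Matrix (Fin m) (Fin m) ℤ) x = x := by
  obtain ⟨v, rfl⟩ := torusMk_surjective x
  rw [toralMap_torusMk, map_one, Module.End.one_apply]

/-- The action of an integer matrix on the torus, as a homomorphism. -/
def toralHom {m : ℕ} (A : Matrix (Fin m) (Fin m) ℤ) :
    (Fin m → UnitAddCircle) →+ (Fin m → UnitAddCircle) where
  toFun := toralMap A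
  map_zero' := by funext i; simp [toralMap]
  map_add' x y := by funext i; simp [toralMap, Finset.sum_add_distrib]

lemma toralHom_apply {m : ℕ} (A : Matrix (Fin m) (Fin m) ℤ) (x : Fin m → UnitAddCircle) :
    toralHom A x = toralMap A x := rfl

lemma continuous_toralHom {m : ℕ} (A : Matrix (Fin m) (Fin m) ℤ) : Continuous (toralHom A) :=
  continuous_pi fun i => continuous_finsetSum Finset.univ fun j _ =>
    (continuous_zsmul (A i j)).comp (continuous_apply j)

lemma toralMap_zpow_add (hβ : IsPisotUnit β) (j k : ℤ) (x : Torus β) :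
    toralMap (companion β ^ (j + k)) x =
      toralMap (companion β ^ j) (toralMap (companion β ^ k) x) := by
  rw [Matrix.zpow_add (isUnit_det_companion hβ), toralMap_mul]

lemma toralMap_zpow_injective (hβ : IsPisotUnit β) (k : ℤ) :
    Function.Injective (toralMap (companion β ^ k)) := by
  refine Function.LeftInverse.injective (g := toralMap (companion β ^ (-k))) fun x => ?_
  rw [← toralMap_zpow_add hβ, neg_add_cancel, zpow_zero, toralMap_one]

lemma linePoint_eq (β ξ : ℝ) : linePoint β ξ = torusMk (ξ • lineVec β β) := rfl

lemma toralMap_linePoint_xiZero (hβ : IsPisotUnit β) (k : ℤ) :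
    toralMap (companion β ^ k) (linePoint β (xiZero β)) = torusMk (β ^ k • baseVec β) := by
  rw [linePoint_eq, toralMap_torusMk, ← companion_zpow_baseVec hβ]
  rfl

/-! ### The group `𝒫_β` -/

lemma continuous_matAct {m : ℕ} (A : Matrix (Fin m) (Fin m) ℤ) : Continuous (matAct ℝ A) :=
  LinearMap.continuous_of_finiteDimensional _

lemma continuous_unstable (β : ℝ) : Continuous (unstable β) :=
  LinearMap.continuous_of_finiteDimensional _

lemma eventually_reduce_companion_eq {r : ℕ → Fin (deg β) → ℝ} (hr : Tendsto r atTop (𝓝 0))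
    (hT : ∀ n, torusMk (r (n + 1)) = toralMap (companion β) (torusMk (r n))) :
    ∀ᶠ n in atTop, r (n + 1) = matAct ℝ (companion β) (r n) := by
  have h := (hr.comp (tendsto_add_atTop_nat 1)).sub
    (((continuous_matAct (companion β)).tendsto 0).comp hr)
  rw [map_zero, sub_zero] at h
  filter_upwards [h.norm.eventually (gt_mem_nhds (by simp : ‖(0 : Fin (deg β) → ℝ)‖ < 1))] with n hn
  obtain ⟨z, hz⟩ := torusMk_eq_zero_iff.1
    (show torusMk (r (n + 1) - matAct ℝ (companion β) (r n)) = 0 by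
      rw [map_sub, hT, toralMap_torusMk, sub_self])
  simp only [Function.comp_apply, hz] at hn
  rw [← sub_eq_zero, hz, eq_zero_of_norm_intVec_lt_one hn, map_zero]

lemma eventually_unstable_eq_zero (hβ : IsPisotUnit β) {r : ℕ → Fin (deg β) → ℝ}
    (hr : Tendsto r atTop (𝓝 0))
    (hT : ∀ᶠ n in atTop, r (n + 1) = matAct ℝ (companion β) (r n)) :
    ∀ᶠ n in atTop, unstable β (r n) = 0 := by
  obtain ⟨N, hN⟩ := eventually_atTop.1 hT
  have hgrow : ∀ n ≥ N, Monotone fun k : ℕ => |unstable β (r (n + k))| := fun n hn =>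
    monotone_nat_of_le_succ fun k => by
      rw [← add_assoc, hN _ (by omega), unstable_companion hβ, smul_eq_mul, abs_mul,
        abs_of_pos hβ.pos]
      exact le_mul_of_one_le_left (abs_nonneg _) hβ.one_lt.le
  have hlim : Tendsto (fun n => |unstable β (r n)|) atTop (𝓝 0) := by
    simpa using (((continuous_unstable β).tendsto 0).comp hr).abs
  filter_upwards [eventually_ge_atTop N] with n hn
  refine abs_nonpos_iff.1 (ge_of_tendsto ((tendsto_add_atTop_iff_nat n).2 hlim) ?_)
  refine Eventually.of_forall fun k => ?_
  rw [add_comm]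
  exact hgrow n hn k.zero_le

lemma tendsto_toralMap_pow_iff (hβ : IsPisotUnit β) (v : Fin (deg β) → ℝ) :
    Tendsto (fun n : ℕ => toralMap (companion β ^ n) (torusMk v)) atTop (𝓝 0) ↔
      unstable β v ∈ ringZ β := by
  constructor
  · intro h
    have hr : Tendsto (fun n : ℕ => reduce (matAct ℝ (companion β ^ n) v)) atTop (𝓝 0) := by
      rw [tendsto_zero_iff_norm_tendsto_zero] at h ⊢
      simpa only [toralMap_torusMk, norm_torusMk] using h
    have hT := eventually_reduce_companion_eq hr fun n => by
      simp only [torusMk_reduce, ← toralMap_torusMk, pow_succ', toralMap_mul]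
    obtain ⟨n, hn⟩ := (eventually_unstable_eq_zero hβ hr hT).exists
    set z : Fin (deg β) → ℤ := round ∘ matAct ℝ (companion β ^ n) v
    have hz : unstable β (matAct ℝ (companion β ^ (n : ℤ)) v - intVec z) = 0 := hn
    suffices h : unstable β v = unstable β (intVec ((companion β ^ (-n : ℤ)).mulVec z)) from
      h ▸ unstable_intVec_mem _
    rw [map_sub, sub_eq_zero, unstable_zpow hβ] at hz
    rw [← matAct_intVec, unstable_zpow hβ, ← hz, ← mul_assoc, ← zpow_add₀ hβ.ne_zero,
      neg_add_cancel, zpow_zero, one_mul]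
  · intro h
    obtain ⟨z, hz⟩ := exists_unstable_intVec_eq hβ h
    have hv : unstable β (v - intVec z) = 0 := by rw [map_sub, hz, sub_self]
    have hlim := (continuous_torusMk.tendsto 0).comp
      (tendsto_companion_pow_of_unstable_eq_zero hβ hv)
    rw [map_zero] at hlim
    refine hlim.congr fun n => ?_
    rw [Function.comp_apply, ← toralMap_torusMk, map_sub, torusMk_intVec, sub_zero]

lemma toralMap_pow_linePoint (hβ : IsPisotUnit β) (ξ : ℝ) (n : ℕ) :
    toralMap (companion β ^ n) (linePoint β ξ) = linePoint β (ξ * β ^ n) := by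
  rw [linePoint_eq, toralMap_torusMk, map_smul, companion_pow_lineVec hβ (minpoly.aeval ℤ β),
    smul_smul, linePoint_eq]

lemma mem_pisotP_iff_tendsto_linePoint (hβ : IsPisotUnit β) {ξ : ℝ} :
    ξ ∈ pisotP β ↔ Tendsto (fun n : ℕ => linePoint β (ξ * β ^ n)) atTop (𝓝 0) := by
  have hmem : ξ ∈ pisotP β ↔
      Tendsto (fun n : ℕ => ((ξ * β ^ n : ℝ) : UnitAddCircle)) atTop (𝓝 0) :=
    tendsto_zero_iff_norm_tendsto_zero.symm
  rw [tendsto_pi_nhds, hmem]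
  refine ⟨fun h i => ?_, fun h => by simpa [linePoint] using h ⟨0, hβ.deg_pos⟩⟩
  rw [← tendsto_add_atTop_iff_nat (i : ℕ)]
  refine h.congr fun n => ?_
  rw [linePoint, pow_add, mul_assoc, mul_assoc, mul_inv_cancel₀ (pow_ne_zero _ hβ.ne_zero), mul_one]

lemma mem_pisotP_iff (hβ : IsPisotUnit β) {ξ : ℝ} :
    ξ ∈ pisotP β ↔ derivAt β * ξ ∈ ringZ β := by
  have h := tendsto_toralMap_pow_iff hβ (ξ • lineVec β β)
  rw [map_smul (unstable β), unstable_lineVec hβ, smul_eq_mul, mul_comm] at h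
  rw [mem_pisotP_iff_tendsto_linePoint hβ, ← h]
  simp only [← linePoint_eq, toralMap_pow_linePoint hβ]

/-! ### The kernel of `g'(T)` on the torus -/

lemma unstable_derivMat (hβ : IsPisotUnit β) (v : Fin (deg β) → ℝ) :
    unstable β (matAct ℝ (derivMat β) v) = derivAt β * unstable β v :=
  unstable_aeval_companion hβ _ v

lemma derivMat_baseVec (hβ : IsPisotUnit β) :
    matAct ℝ (derivMat β) (baseVec β) = lineVec β β := by
  rw [derivMat, ← aeval_matAct, baseVec, map_smul,
    aeval_apply_of_eigenvector (companion_lineVec hβ (minpoly.aeval ℤ β)), smul_smul,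
    show xiZero β = (derivAt β)⁻¹ from rfl, ← derivAt, inv_mul_cancel₀ (derivAt_ne_zero hβ),
    one_smul]

lemma matAct_bijective {K : Type*} [Field K] [CharZero K] {m : ℕ} {A : Matrix (Fin m) (Fin m) ℤ}
    (hA : A.det ≠ 0) : Function.Bijective (matAct K A) := by
  have hinj : Function.Injective (matAct K A) := by
    rw [injective_iff_map_eq_zero]
    intro v hv
    have h : matAct K (A.adjugate * A) v = 0 := by
      rw [map_mul, Module.End.mul_apply, hv, map_zero]
    rw [Matrix.adjugate_mul, map_zsmul, map_one] at h
    exact (smul_eq_zero.1 h).resolve_left hA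
  exact ⟨hinj, LinearMap.injective_iff_surjective.1 hinj⟩

lemma finite_ker_toralHom {m : ℕ} {A : Matrix (Fin m) (Fin m) ℤ} (hA : A.det ≠ 0) :
    ((toralHom A).ker : Set (Fin m → UnitAddCircle)).Finite := by
  have hfin : {x : UnitAddCircle | A.det.natAbs • x = 0}.Finite :=
    AddCircle.finite_torsion 1 (Int.natAbs_pos.2 hA)
  refine (Set.Finite.pi' fun _ => hfin).subset fun x hx i => ?_
  have h : toralMap (A.adjugate * A) x = 0 := by
    rw [toralMap_mul, ← toralHom_apply A, AddMonoidHom.mem_ker.1 hx, ← toralHom_apply, map_zero]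
  have hi := congrFun h i
  rw [Matrix.adjugate_mul] at hi
  simpa [toralMap, Matrix.one_apply] using hi

/-- The preimage in `ℝ^m` of the kernel of `g'(T)` on the torus. -/
noncomputable def kerLattice (β : ℝ) : AddSubgroup (Fin (deg β) → ℝ) :=
  ((toralHom (derivMat β)).comp torusMk).ker

lemma mem_kerLattice_iff {u : Fin (deg β) → ℝ} :
    u ∈ kerLattice β ↔ ∃ z, matAct ℝ (derivMat β) u = intVec z := by
  rw [← torusMk_eq_zero_iff, ← toralMap_torusMk]
  rfl

lemma unstable_mem_pisotP_of_mem_kerLattice (hβ : IsPisotUnit β) {u : Fin (deg β) → ℝ}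
    (hu : u ∈ kerLattice β) : unstable β u ∈ pisotP β := by
  obtain ⟨z, hz⟩ := mem_kerLattice_iff.1 hu
  rw [mem_pisotP_iff hβ, ← unstable_derivMat hβ, hz]
  exact unstable_intVec_mem z

lemma exists_mem_kerLattice (hβ : IsPisotUnit β) {ξ : ℝ} (hξ : ξ ∈ pisotP β) :
    ∃ u ∈ kerLattice β, unstable β u = ξ := by
  obtain ⟨z, hz⟩ := exists_unstable_intVec_eq hβ ((mem_pisotP_iff hβ).1 hξ)
  obtain ⟨u, hu⟩ := (matAct_bijective (det_derivMat_ne_zero hβ)).2 (intVec z)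
  refine ⟨u, mem_kerLattice_iff.2 ⟨z, hu⟩, mul_left_cancel₀ (derivAt_ne_zero hβ) ?_⟩
  rw [← unstable_derivMat hβ, hu, hz]

lemma eq_zero_of_mem_kerLattice (hβ : IsPisotUnit β) {u : Fin (deg β) → ℝ}
    (hu : u ∈ kerLattice β) (h : unstable β u = 0) : u = 0 := by
  obtain ⟨z, hz⟩ := mem_kerLattice_iff.1 hu
  have hz0 : z = 0 :=
    eq_zero_of_unstable_intVec hβ (by rw [← hz, unstable_derivMat hβ, h, mul_zero])
  refine (matAct_bijective (det_derivMat_ne_zero hβ)).1 ?_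
  rw [hz, hz0, map_zero, map_zero]

/-- The unstable functional identifies `g'(T)⁻¹ ℤ^m` with `𝒫_β = g'(β)⁻¹ ℤ[β]`. -/
noncomputable def latticeEquiv (hβ : IsPisotUnit β) : kerLattice β ≃+ pisotP β :=
  AddEquiv.ofBijective
    (((unstable β).toAddMonoidHom.comp (kerLattice β).subtype).codRestrict (pisotP β)
      fun u => unstable_mem_pisotP_of_mem_kerLattice hβ u.2)
    ⟨(injective_iff_map_eq_zero _).2 fun u hu =>
      Subtype.ext (eq_zero_of_mem_kerLattice hβ u.2 (congrArg Subtype.val hu)),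
    fun ξ => (exists_mem_kerLattice hβ ξ.2).elim fun u hu => ⟨⟨u, hu.1⟩, Subtype.ext hu.2⟩⟩

lemma coe_latticeEquiv (hβ : IsPisotUnit β) (u : kerLattice β) :
    (latticeEquiv hβ u : ℝ) = unstable β u := rfl

/-- The homomorphism `𝒫_β → 𝕋^m` with kernel `ℤ[β]` and image the kernel of `g'(T)`. -/
noncomputable def pisotHom (hβ : IsPisotUnit β) : pisotP β →+ (toralHom (derivMat β)).ker :=
  ((torusMk.comp (kerLattice β).subtype).codRestrict (toralHom (derivMat β)).ker
    fun u => u.2).comp (latticeEquiv hβ).symm.toAddMonoidHom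

lemma pisotHom_latticeEquiv (hβ : IsPisotUnit β) (u : kerLattice β) :
    (pisotHom hβ (latticeEquiv hβ u) : Torus β) = torusMk u :=
  congrArg (fun w : kerLattice β => torusMk (w : Fin (deg β) → ℝ))
    ((latticeEquiv hβ).symm_apply_apply u)

lemma pisotHom_surjective (hβ : IsPisotUnit β) : Function.Surjective (pisotHom hβ) := by
  rintro ⟨x, hx⟩
  obtain ⟨v, rfl⟩ := torusMk_surjective x
  exact ⟨latticeEquiv hβ ⟨v, hx⟩, Subtype.ext (pisotHom_latticeEquiv hβ _)⟩

lemma ker_pisotHom (hβ : IsPisotUnit β) :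
    (pisotHom hβ).ker = (ringZ β).addSubgroupOf (pisotP β) := by
  ext ξ
  obtain ⟨⟨u, hu⟩, rfl⟩ := (latticeEquiv hβ).surjective ξ
  rw [AddMonoidHom.mem_ker, AddSubgroup.mem_addSubgroupOf, ← ZeroMemClass.coe_eq_zero,
    pisotHom_latticeEquiv, torusMk_eq_zero_iff, coe_latticeEquiv]
  refine ⟨fun ⟨z, hz⟩ => hz ▸ unstable_intVec_mem z, fun h => ?_⟩
  obtain ⟨z, hz⟩ := exists_unstable_intVec_eq hβ h
  refine ⟨z, sub_eq_zero.1 (eq_zero_of_mem_kerLattice hβ (sub_mem hu ?_) ?_)⟩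
  · exact mem_kerLattice_iff.2 ⟨_, matAct_intVec _ z⟩
  · rw [map_sub, hz, sub_self]

/-- The Pisot group is isomorphic to the kernel of `g'(T)` on the torus. -/
noncomputable def pisotEquiv (hβ : IsPisotUnit β) :
    PisotGroup β ≃+ (toralHom (derivMat β)).ker :=
  (QuotientAddGroup.quotientAddEquivOfEq (ker_pisotHom hβ).symm).trans
    (QuotientAddGroup.quotientKerEquivOfSurjective _ (pisotHom_surjective hβ))

lemma pisotEquiv_mk (hβ : IsPisotUnit β) (ξ : pisotP β) :
    pisotEquiv hβ (QuotientAddGroup.mk ξ) = pisotHom hβ ξ := rfl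

/-! ### The real lift of the coding -/

/-- A lift of `T^{-k} t₀` to `ℝ^m`, where `t₀ = (ξ₀, ξ₀β⁻¹, …, ξ₀β^{-m+1})`. Subtracting the integer
vector moves `t₀` to the stable space, so that the lifts decay exponentially at both ends. -/
noncomputable def liftTerm (β : ℝ) (k : ℤ) : Fin (deg β) → ℝ :=
  if 0 < k then β ^ (-k) • baseVec β
  else matAct ℝ (companion β ^ (-k)) (baseVec β - intVec (unitVec β))

lemma unstable_baseVec_sub_unitVec (hβ : IsPisotUnit β) :
    unstable β (baseVec β - intVec (unitVec β)) = 0 := by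
  rw [map_sub, unstable_baseVec hβ, unstable_unitVec hβ, sub_self]

lemma unstable_liftTerm_of_pos (hβ : IsPisotUnit β) {k : ℤ} (hk : 0 < k) :
    unstable β (liftTerm β k) = β ^ (-k) := by
  rw [liftTerm, if_pos hk, map_smul, unstable_baseVec hβ, smul_eq_mul, mul_one]

lemma unstable_liftTerm_of_nonpos (hβ : IsPisotUnit β) {k : ℤ} (hk : k ≤ 0) :
    unstable β (liftTerm β k) = 0 := by
  rw [liftTerm, if_neg hk.not_gt, unstable_zpow hβ, unstable_baseVec_sub_unitVec hβ, mul_zero]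

lemma torusMk_liftTerm (hβ : IsPisotUnit β) (k : ℤ) :
    torusMk (liftTerm β k) = toralMap (companion β ^ (-k)) (linePoint β (xiZero β)) := by
  rw [toralMap_linePoint_xiZero hβ, liftTerm]
  split_ifs with hk
  · rfl
  · rw [map_sub, matAct_intVec, companion_zpow_baseVec hβ, map_sub, torusMk_intVec, sub_zero]

lemma summable_norm_liftTerm (hβ : IsPisotUnit β) : Summable fun k => ‖liftTerm β k‖ := by
  apply Summable.of_nat_of_neg
  · rw [← summable_nat_add_iff 1]
    have hgeom : Summable fun n : ℕ => (β⁻¹) ^ (n + 1) * ‖baseVec β‖ :=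
      ((summable_nat_add_iff 1).2 (summable_geometric_of_lt_one (inv_nonneg.2 hβ.pos.le)
        (inv_lt_one_of_one_lt₀ hβ.one_lt))).mul_right _
    refine hgeom.congr fun n => ?_
    rw [liftTerm, if_pos (by positivity), norm_smul, zpow_neg, zpow_natCast, ← inv_pow,
      Real.norm_of_nonneg (pow_nonneg (inv_nonneg.2 hβ.pos.le) _)]
  · obtain ⟨ρ, h0, h1, hrate⟩ := exists_rate hβ
    obtain ⟨D, hD⟩ := hrate _ (unstable_baseVec_sub_unitVec hβ)
    refine Summable.of_nonneg_of_le (fun _ => norm_nonneg _) (fun n => ?_)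
      ((summable_geometric_of_lt_one h0.le h1).mul_left D)
    rw [liftTerm, if_neg (by simp), neg_neg, zpow_natCast]
    exact hD n

/-- The value `∑ s_i β^{-i-1}` of a one-sided sequence. -/
noncomputable def val (β : ℝ) (s : ℕ → ℕ) : ℝ := ∑' i, (s i : ℝ) * (β ^ (i + 1))⁻¹

lemma summable_val (hβ : 1 < β) {s : ℕ → ℕ} {c : ℕ} (hc : ∀ i, s i ≤ c) :
    Summable fun i => (s i : ℝ) * (β ^ (i + 1))⁻¹ := by
  have h0 : 0 < β := one_pos.trans hβ
  have hgeom : Summable fun n : ℕ => (c : ℝ) * (β⁻¹) ^ (n + 1) :=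
    ((summable_nat_add_iff 1).2 (summable_geometric_of_lt_one (inv_nonneg.2 h0.le)
      (inv_lt_one_of_one_lt₀ hβ))).mul_left _
  refine Summable.of_nonneg_of_le (fun i => by positivity) (fun i => ?_) hgeom
  rw [inv_pow]
  have := hc i
  gcongr

lemma tsum_int_of_nonpos {E : Type*} [AddCommGroup E] [TopologicalSpace E] [T2Space E]
    {f : ℤ → E} (hf : ∀ k ≤ 0, f k = 0) : ∑' k, f k = ∑' i : ℕ, f (1 + i) := by
  have hinj : Function.Injective fun i : ℕ => (1 + i : ℤ) := fun a b h => by simpa using h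
  refine (hinj.tsum_eq fun k hk => ?_).symm
  have hk0 : 0 < k := not_le.1 fun h => hk (hf k h)
  exact ⟨(k - 1).toNat, by simp; omega⟩

lemma zpow_neg_one_add (β : ℝ) (i : ℕ) : β ^ (-(1 + i : ℤ)) = (β ^ (i + 1))⁻¹ := by
  rw [zpow_neg, add_comm, ← Nat.cast_succ, zpow_natCast]

/-- The lift of `∑ ε_k T^{-k} t₀` to `ℝ^m`. -/
noncomputable def realCode (β : ℝ) (ε : ℤ → ℕ) : Fin (deg β) → ℝ :=
  ∑' k, (ε k : ℝ) • liftTerm β k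

section BoundedDigits

variable {ε : ℤ → ℕ} {c : ℕ}

lemma norm_smul_liftTerm_le (hc : ∀ k, ε k ≤ c) (k : ℤ) :
    ‖(ε k : ℝ) • liftTerm β k‖ ≤ c * ‖liftTerm β k‖ := by
  rw [norm_smul, Real.norm_natCast]
  have := hc k
  gcongr

lemma summable_realCode (hβ : IsPisotUnit β) (hc : ∀ k, ε k ≤ c) :
    Summable fun k => (ε k : ℝ) • liftTerm β k :=
  Summable.of_norm_bounded ((summable_norm_liftTerm hβ).mul_left (c : ℝ)) (norm_smul_liftTerm_le hc)

lemma norm_realCode_le (hβ : IsPisotUnit β) (hc : ∀ k, ε k ≤ c) :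
    ‖realCode β ε‖ ≤ ∑' k, c * ‖liftTerm β k‖ :=
  tsum_of_norm_bounded ((summable_norm_liftTerm hβ).mul_left (c : ℝ)).hasSum
    (norm_smul_liftTerm_le hc)

lemma continuousOn_realCode (hβ : IsPisotUnit β) (c : ℕ) :
    ContinuousOn (realCode β) {ε | ∀ k, ε k ≤ c} := by
  refine continuousOn_tsum (u := fun k => c * ‖liftTerm β k‖) (fun k => ?_)
    ((summable_norm_liftTerm hβ).mul_left (c : ℝ)) fun k ε hε => norm_smul_liftTerm_le hε k
  exact (((continuous_of_discreteTopology (f := fun n : ℕ => (n : ℝ))).comp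
    (continuous_apply k)).smul continuous_const).continuousOn

lemma hasSum_torusMk_realCode (hβ : IsPisotUnit β) (hc : ∀ k, ε k ≤ c) :
    HasSum (fun k => ε k • toralMap (companion β ^ (-k)) (linePoint β (xiZero β)))
      (torusMk (realCode β ε)) := by
  refine ((summable_realCode hβ hc).hasSum.map torusMk continuous_torusMk).congr_fun fun k => ?_
  rw [Function.comp_apply, Nat.cast_smul_eq_nsmul, map_nsmul, torusMk_liftTerm hβ]

lemma torusMk_realCode_shift (hβ : IsPisotUnit β) (hc : ∀ k, ε k ≤ c) (j : ℤ) :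
    torusMk (realCode β fun k => ε (k + j)) =
      toralMap (companion β ^ j) (torusMk (realCode β ε)) := by
  have h := (hasSum_torusMk_realCode hβ hc).map (toralHom (companion β ^ j)) (continuous_toralHom _)
  rw [← (Equiv.addRight j).hasSum_iff] at h
  refine (hasSum_torusMk_realCode hβ fun k => hc (k + j)).unique (h.congr_fun fun k => ?_)
  simp only [Function.comp_apply, Equiv.coe_addRight, map_nsmul, toralHom_apply]
  rw [← toralMap_zpow_add hβ, neg_add_rev, add_neg_cancel_left]

lemma unstable_realCode (hβ : IsPisotUnit β) (hc : ∀ k, ε k ≤ c) :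
    unstable β (realCode β ε) = val β fun i => ε (1 + i) := by
  have h := (LinearMap.toContinuousLinearMap (unstable β)).map_tsum (summable_realCode hβ hc)
  rw [LinearMap.coe_toContinuousLinearMap'] at h
  rw [realCode, h, tsum_int_of_nonpos, val]
  · refine tsum_congr fun i => ?_
    rw [map_smul, unstable_liftTerm_of_pos hβ (by positivity), zpow_neg_one_add, smul_eq_mul]
  · intro k hk
    rw [map_smul, unstable_liftTerm_of_nonpos hβ hk, smul_zero]

lemma realCode_of_nonpos (hβ : IsPisotUnit β) (hc : ∀ k, ε k ≤ c) (h0 : ∀ k ≤ 0, ε k = 0) :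
    realCode β ε = (val β fun i => ε (1 + i)) • baseVec β := by
  rw [realCode, tsum_int_of_nonpos fun k hk => by simp [h0 k hk], val,
    ← (summable_val hβ.one_lt fun i => hc (1 + i)).tsum_smul_const]
  refine tsum_congr fun i => ?_
  rw [liftTerm, if_pos (by positivity), zpow_neg_one_add, smul_smul]

end BoundedDigits

/-! ### The coding `φ` in terms of `φ₀` -/

lemma codingTerm_one (hβ : IsPisotUnit β) (ε : compactum β) (k : ℤ) :
    codingTerm β 1 ε k = toralHom (derivMat β) (codingTerm β (xiZero β) ε k) := by
  rw [codingTerm, codingTerm, map_nsmul, toralMap_linePoint_xiZero hβ, toralHom_apply,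
    toralMap_torusMk, map_smul, derivMat_baseVec hβ, linePoint_eq, one_smul, toralMap_torusMk,
    companion_zpow_lineVec hβ]

lemma LexLT.apply_zero_le {x y : ℕ → ℕ} : LexLT x y → x 0 ≤ y 0
  | ⟨0, _, h⟩ => h.le
  | ⟨n + 1, h, _⟩ => (h 0 n.succ_pos).le

lemma apply_le_of_mem_compactum {ε : ℤ → ℕ} (hε : ε ∈ compactum β) (k : ℤ) :
    ε k ≤ quasiGreedy β 0 := by
  simpa using (hε k).apply_zero_le

lemma hasSum_phiZero (hβ : IsPisotUnit β) (ε : compactum β) :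
    HasSum (codingTerm β (xiZero β) ε) (torusMk (realCode β ε.1)) :=
  hasSum_torusMk_realCode hβ (apply_le_of_mem_compactum ε.2)

lemma phiZero_eq (hβ : IsPisotUnit β) (ε : compactum β) :
    phiZero β ε = torusMk (realCode β ε.1) := (hasSum_phiZero hβ ε).tsum_eq

lemma hasSum_phi (hβ : IsPisotUnit β) (ε : compactum β) :
    HasSum (codingTerm β 1 ε) (toralHom (derivMat β) (phiZero β ε)) := by
  rw [phiZero_eq hβ, funext (codingTerm_one hβ ε)]
  exact (hasSum_phiZero hβ ε).map (toralHom (derivMat β)) (continuous_toralHom _)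

lemma phi_eq (hβ : IsPisotUnit β) (ε : compactum β) :
    phi β ε = toralHom (derivMat β) (phiZero β ε) := (hasSum_phi hβ ε).tsum_eq

/-! ### Digit sequences and their orbits -/

/-- `y` is the sequence of remainders obtained from `y 0` by splitting off the digits `d` one after
the other; no bound on the digits or on the remainders is imposed. -/
def IsOrbit (β : ℝ) (d : ℕ → ℕ) (y : ℕ → ℝ) : Prop := ∀ n, y (n + 1) = β * y n - d n

namespace IsOrbit

variable {x y : ℕ → ℝ} {d e : ℕ → ℕ}

lemma zero (β : ℝ) : IsOrbit β 0 0 := fun n => by simp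

lemma shift (hy : IsOrbit β d y) (k : ℕ) :
    IsOrbit β (fun n => d (k + n)) fun n => y (k + n) := fun n => hy (k + n)

lemma sub_eq_pow_mul (hy : IsOrbit β d y) (hx : IsOrbit β e x) {n : ℕ}
    (h : ∀ i < n, d i = e i) : y n - x n = β ^ n * (y 0 - x 0) := by
  induction n with
  | zero => simp
  | succ n ih =>
    rw [hy, hx, h n n.lt_succ_self, pow_succ', mul_assoc, ← ih fun i hi => h i (by omega)]
    ring

lemma le_of_forall_sub_le (hβ : 1 < β) (hy : IsOrbit β d y) (hx : IsOrbit β d x) {D : ℝ}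
    (h : ∀ n, y n - x n ≤ D) : y 0 ≤ x 0 := by
  by_contra! hlt
  obtain ⟨n, hn⟩ := pow_unbounded_of_one_lt (D / (y 0 - x 0)) hβ
  rw [div_lt_iff₀ (sub_pos.2 hlt), ← hy.sub_eq_pow_mul hx fun _ _ => rfl] at hn
  exact (h n).not_gt hn

lemma sub_succ_of_first_diff (hy : IsOrbit β d y) (hx : IsOrbit β e x) {n : ℕ}
    (h : ∀ i < n, d i = e i) :
    y (n + 1) - x (n + 1) = β ^ (n + 1) * (y 0 - x 0) + (e n - d n) := by
  rw [hy, hx, pow_succ', mul_assoc, ← hy.sub_eq_pow_mul hx h]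
  ring

lemma not_lexLT_of_le (hβ : 1 < β) (hy : IsOrbit β d y) (hx : IsOrbit β e x) (h0 : x 0 ≤ y 0)
    (h1 : ∀ n, y n - x n < 1) : ¬ LexLT d e := by
  rintro ⟨n, heq, hlt⟩
  have hdiff := hy.sub_succ_of_first_diff hx heq
  have hdigit : (d n : ℝ) + 1 ≤ e n := mod_cast hlt
  have hpow : 0 ≤ β ^ (n + 1) * (y 0 - x 0) :=
    mul_nonneg (pow_nonneg (one_pos.trans hβ).le _) (sub_nonneg.2 h0)
  linarith [h1 (n + 1)]

lemma not_lexLT_of_lt (hβ : 1 < β) (hy : IsOrbit β d y) (hx : IsOrbit β e x) (h0 : x 0 < y 0)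
    (h1 : ∀ n, y n - x n ≤ 1) : ¬ LexLT d e := by
  rintro ⟨n, heq, hlt⟩
  have hdiff := hy.sub_succ_of_first_diff hx heq
  have hdigit : (d n : ℝ) + 1 ≤ e n := mod_cast hlt
  have hpow : 0 < β ^ (n + 1) * (y 0 - x 0) :=
    mul_pos (pow_pos (one_pos.trans hβ) _) (sub_pos.2 h0)
  linarith [h1 (n + 1)]

lemma periodic (hy : IsOrbit β d y) {p : ℕ} (hp : 0 < p) (h0 : y 0 = 1) (hyp : y p = 0)
    (hd : d (p - 1) ≠ 0) :
    IsOrbit β (fun n => if n % p + 1 = p then d (n % p) - 1 else d (n % p))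
      fun n => y (n % p) := by
  intro n
  beta_reduce
  have hlt := Nat.mod_lt n hp
  by_cases hc : n % p + 1 = p
  · have hnext : (n + 1) % p = 0 := by rw [← Nat.mod_add_mod, hc, Nat.mod_self]
    have hlast : n % p = p - 1 := by omega
    have hstep := hy (p - 1)
    rw [Nat.sub_add_cancel hp, hyp] at hstep
    rw [if_pos hc, hnext, h0, hlast, Nat.cast_pred (Nat.pos_of_ne_zero hd)]
    linarith
  · have hnext : (n + 1) % p = n % p + 1 := by
      rw [← Nat.mod_add_mod, Nat.mod_eq_of_lt (by omega)]
    rw [if_neg hc, hnext]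
    exact hy _

lemma val_eq (hβ : 1 < β) (hy : IsOrbit β d y) (h0 : ∀ n, 0 ≤ y n) (h1 : ∀ n, y n ≤ 1) :
    val β d = y 0 := by
  have hβ0 : 0 < β := one_pos.trans hβ
  have hpartial : ∀ n, ∑ i ∈ Finset.range n, (d i : ℝ) * (β ^ (i + 1))⁻¹ =
      y 0 - y n * (β ^ n)⁻¹ := by
    intro n
    induction n with
    | zero => simp
    | succ n ih =>
      rw [Finset.sum_range_succ, ih, hy, pow_succ]
      field_simp
      ring
  have hrem : Tendsto (fun n => y n * (β ^ n)⁻¹) atTop (𝓝 0) := by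
    refine squeeze_zero (fun n => mul_nonneg (h0 n) (by positivity)) (fun n => ?_)
      (tendsto_pow_atTop_nhds_zero_of_lt_one (inv_nonneg.2 hβ0.le) (inv_lt_one_of_one_lt₀ hβ))
    rw [inv_pow]
    exact mul_le_of_le_one_left (by positivity) (h1 n)
  refine HasSum.tsum_eq ((hasSum_iff_tendsto_nat_of_nonneg (fun _ => by positivity) _).2 ?_)
  simpa only [hpartial, sub_zero] using hrem.const_sub (y 0)

end IsOrbit

lemma val_nonneg (hβ : 1 < β) (s : ℕ → ℕ) : 0 ≤ val β s :=
  tsum_nonneg fun _ => mul_nonneg (Nat.cast_nonneg _)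
    (inv_nonneg.2 (pow_nonneg (one_pos.trans hβ).le _))

lemma val_mono (hβ : 1 < β) {s t : ℕ → ℕ} {c : ℕ} (hst : ∀ i, s i ≤ t i) (hc : ∀ i, t i ≤ c) :
    val β s ≤ val β t := by
  have : 0 < β := one_pos.trans hβ
  refine (summable_val hβ fun i => (hst i).trans (hc i)).tsum_le_tsum (fun i => ?_)
    (summable_val hβ hc)
  have := hst i
  gcongr

lemma val_succ (hβ : 1 < β) {s : ℕ → ℕ} {c : ℕ} (hc : ∀ i, s i ≤ c) :
    val β (fun i => s (i + 1)) = β * val β s - s 0 := by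
  have hβ0 : β ≠ 0 := (one_pos.trans hβ).ne'
  have hterm : ∀ i, β * ((s (i + 1) : ℝ) * (β ^ (i + 1 + 1))⁻¹) =
      (s (i + 1) : ℝ) * (β ^ (i + 1))⁻¹ := fun i => by
    rw [pow_succ β (i + 1)]
    field_simp
  rw [val, val, (summable_val hβ hc).tsum_eq_zero_add, mul_add, ← tsum_mul_left]
  simp only [hterm, zero_add, pow_one]
  field_simp
  ring

lemma isOrbit_val (hβ : 1 < β) {s : ℕ → ℕ} {c : ℕ} (hc : ∀ i, s i ≤ c) :
    IsOrbit β s fun n => val β fun i => s (n + i) := fun n => by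
  simpa only [add_assoc, add_comm 1, add_zero] using val_succ hβ fun i => hc (n + i)

/-! ### The greedy orbit -/

/-- The orbit of `x` under the `β`-transformation `y ↦ {βy}`. -/
noncomputable def orbit (β x : ℝ) (n : ℕ) : ℝ := (fun y : ℝ => Int.fract (β * y))^[n] x

lemma orbit_zero (β x : ℝ) : orbit β x 0 = x := rfl

lemma orbit_succ (β x : ℝ) (n : ℕ) : orbit β x (n + 1) = Int.fract (β * orbit β x n) :=
  Function.iterate_succ_apply' _ _ _

lemma orbit_add (β x : ℝ) (n k : ℕ) : orbit β x (n + k) = orbit β (orbit β x n) k := by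
  rw [add_comm]
  exact Function.iterate_add_apply _ _ _ _

lemma digit_eq (β x : ℝ) (n : ℕ) : digit β x n = ⌊β * orbit β x n⌋₊ := rfl

lemma digit_add (β x : ℝ) (n k : ℕ) : digit β x (n + k) = digit β (orbit β x n) k := by
  rw [digit_eq, digit_eq, orbit_add]

lemma orbit_nonneg {x : ℝ} (hx : 0 ≤ x) : ∀ n, 0 ≤ orbit β x n
  | 0 => hx
  | n + 1 => by rw [orbit_succ]; exact Int.fract_nonneg _

lemma orbit_lt_one {x : ℝ} (hx : x < 1) : ∀ n, orbit β x n < 1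
  | 0 => hx
  | n + 1 => by rw [orbit_succ]; exact Int.fract_lt_one _

lemma orbit_le_one {x : ℝ} (hx : x ≤ 1) : ∀ n, orbit β x n ≤ 1
  | 0 => hx
  | n + 1 => by rw [orbit_succ]; exact (Int.fract_lt_one _).le

lemma fract_eq_sub_natFloor {a : ℝ} (ha : 0 ≤ a) : Int.fract a = a - ⌊a⌋₊ := by
  rw [Int.fract, natCast_floor_eq_intCast_floor ha]

lemma isOrbit_orbit (hβ : 1 < β) {x : ℝ} (hx : 0 ≤ x) : IsOrbit β (digit β x) (orbit β x) :=
  fun n => by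
    rw [orbit_succ, digit_eq,
      fract_eq_sub_natFloor (mul_nonneg (one_pos.trans hβ).le (orbit_nonneg hx n))]

lemma val_digit (hβ : 1 < β) {x : ℝ} (hx : 0 ≤ x) (hx1 : x < 1) : val β (digit β x) = x :=
  (isOrbit_orbit hβ hx).val_eq hβ (orbit_nonneg hx) (orbit_le_one hx1.le)

lemma orbit_eq_zero_of_le {x : ℝ} {n : ℕ} (h : orbit β x n = 0) {j : ℕ} (hj : n ≤ j) :
    orbit β x j = 0 := by
  induction j, hj using Nat.le_induction with
  | base => exact h
  | succ j _ ih => rw [orbit_succ, ih, mul_zero, Int.fract_zero]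

lemma orbit_eq_zero_iff (hβ : 1 < β) {x : ℝ} (hx : 0 ≤ x) (hx1 : x ≤ 1) (n : ℕ) :
    orbit β x n = 0 ↔ ∀ j ≥ n, digit β x j = 0 := by
  refine ⟨fun h j hj => by rw [digit_eq, orbit_eq_zero_of_le h hj, mul_zero, Nat.floor_zero],
    fun h => le_antisymm ?_ (orbit_nonneg hx n)⟩
  have hzero : (fun i => digit β x (n + i)) = 0 := funext fun i => h _ (Nat.le_add_right n i)
  refine ((isOrbit_orbit hβ hx).shift n).le_of_forall_sub_le hβ (x := 0) (D := 1)
    (hzero ▸ IsOrbit.zero β) fun i => ?_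
  rw [Pi.zero_apply, sub_zero]
  exact orbit_le_one hx1 _

/-! ### The quasi-greedy orbit of `1` -/

open Classical in
/-- The remainders that belong to the digits `quasiGreedy β`: the orbit of `1` under the
`β`-transformation, restarted from `1` instead of reaching `0`. -/
noncomputable def quasiOrbit (β : ℝ) (n : ℕ) : ℝ :=
  if h : ∃ K, ∀ j ≥ K, digit β 1 j = 0 then orbit β 1 (n % Nat.find h) else orbit β 1 n

lemma digit_one_zero_ne_zero (hβ : 1 < β) : digit β 1 0 ≠ 0 := by
  rw [digit_eq, orbit_zero, mul_one, Ne, Nat.floor_eq_zero, not_lt]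
  exact hβ.le

open Classical in
lemma find_digit_one_pos (hβ : 1 < β) (h : ∃ K, ∀ j ≥ K, digit β 1 j = 0) : 0 < Nat.find h :=
  Nat.pos_of_ne_zero fun h0 => digit_one_zero_ne_zero hβ (Nat.find_spec h 0 h0.le)

lemma quasiOrbit_zero (β : ℝ) : quasiOrbit β 0 = 1 := by
  simp [quasiOrbit, orbit_zero]

lemma quasiOrbit_le_one (β : ℝ) (n : ℕ) : quasiOrbit β n ≤ 1 := by
  unfold quasiOrbit
  split_ifs <;> exact orbit_le_one le_rfl _

lemma quasiOrbit_pos (hβ : 1 < β) (n : ℕ) : 0 < quasiOrbit β n := by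
  classical
  have hzero := orbit_eq_zero_iff hβ zero_le_one le_rfl
  unfold quasiOrbit
  split_ifs with h <;> refine (orbit_nonneg zero_le_one _).lt_of_ne' fun h0 => ?_
  · exact Nat.find_min h (Nat.mod_lt n (find_digit_one_pos hβ h)) ((hzero _).1 h0)
  · exact h ⟨n, (hzero n).1 h0⟩

lemma isOrbit_quasiOrbit (hβ : 1 < β) : IsOrbit β (quasiGreedy β) (quasiOrbit β) := by
  classical
  have horbit := isOrbit_orbit hβ zero_le_one
  by_cases h : ∃ K, ∀ j ≥ K, digit β 1 j = 0
  · have hp := find_digit_one_pos hβ h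
    have hlast : digit β 1 (Nat.find h - 1) ≠ 0 := fun h0 =>
      Nat.find_min h (Nat.sub_one_lt hp.ne') fun j hj => by
        rcases hj.eq_or_lt with rfl | hj
        · exact h0
        · exact Nat.find_spec h j (by omega)
    intro n
    simp only [quasiGreedy, quasiOrbit, dif_pos h]
    exact horbit.periodic hp (orbit_zero β 1)
      ((orbit_eq_zero_iff hβ zero_le_one le_rfl _).2 (Nat.find_spec h)) hlast n
  · intro n
    simp only [quasiGreedy, quasiOrbit, dif_neg h]
    exact horbit n

lemma val_quasiGreedy (hβ : 1 < β) : val β (quasiGreedy β) = 1 := by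
  rw [(isOrbit_quasiOrbit hβ).val_eq hβ (fun n => (quasiOrbit_pos hβ n).le) (quasiOrbit_le_one β),
    quasiOrbit_zero]

lemma quasiGreedy_zero_pos (hβ : 1 < β) : 0 < quasiGreedy β 0 := by
  have hstep := isOrbit_quasiOrbit hβ 0
  rw [quasiOrbit_zero, mul_one] at hstep
  have hpos : (0 : ℝ) < quasiGreedy β 0 := by linarith [quasiOrbit_le_one β 1]
  exact_mod_cast hpos

lemma exists_quasiGreedy_ne_zero (hβ : 1 < β) (n : ℕ) : ∃ j ≥ n, quasiGreedy β j ≠ 0 := by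
  by_contra! h
  have hzero : (fun i => quasiGreedy β (n + i)) = 0 := funext fun i => h _ (Nat.le_add_right n i)
  refine (quasiOrbit_pos hβ n).not_ge <| ((isOrbit_quasiOrbit hβ).shift n).le_of_forall_sub_le hβ
    (x := 0) (D := 1) (hzero ▸ IsOrbit.zero β) fun i => ?_
  rw [Pi.zero_apply, sub_zero]
  exact quasiOrbit_le_one β _

/-! ### Lexicographic comparison with the quasi-greedy expansion -/

lemma LexLT.asymm {s d : ℕ → ℕ} (h : LexLT s d) : ¬ LexLT d s := by
  obtain ⟨n, hn, hlt⟩ := h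
  rintro ⟨k, hk, hgt⟩
  rcases lt_trichotomy n k with h | rfl | h
  · exact hlt.ne (hk n h).symm
  · exact hlt.asymm hgt
  · exact hgt.ne (hn k h).symm

lemma lexLT_trichotomy (s d : ℕ → ℕ) : LexLT s d ∨ s = d ∨ LexLT d s := by
  classical
  by_cases h : ∃ n, s n ≠ d n
  · have heq : ∀ i < Nat.find h, s i = d i := fun i hi => not_not.1 (Nat.find_min h hi)
    rcases (Nat.find_spec h).lt_or_gt with hlt | hgt
    · exact .inl ⟨_, heq, hlt⟩
    · exact .inr (.inr ⟨_, fun i hi => (heq i hi).symm, hgt⟩)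
  · exact .inr (.inl (funext fun n => not_not.1 fun hn => h ⟨n, hn⟩))

lemma not_lexLT_quasiGreedy_shift (hβ : 1 < β) (k : ℕ) :
    ¬ LexLT (quasiGreedy β) fun i => quasiGreedy β (k + i) := by
  have horbit := isOrbit_quasiOrbit hβ
  refine horbit.not_lexLT_of_le hβ (horbit.shift k) ?_ fun n => ?_
  · rw [quasiOrbit_zero]
    exact quasiOrbit_le_one β _
  · linarith [quasiOrbit_pos hβ (k + n), quasiOrbit_le_one β n]

lemma lexLT_digit (hβ : 1 < β) {x : ℝ} (hx : 0 ≤ x) (hx1 : x < 1) :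
    LexLT (digit β x) (quasiGreedy β) := by
  rcases lexLT_trichotomy (digit β x) (quasiGreedy β) with h | h | h
  · exact h
  · refine absurd ?_ hx1.ne
    rw [← val_digit hβ hx hx1, h, val_quasiGreedy hβ]
  · refine absurd h ((isOrbit_quasiOrbit hβ).not_lexLT_of_lt hβ (isOrbit_orbit hβ hx) ?_
      fun n => ?_)
    · rwa [quasiOrbit_zero, orbit_zero]
    · linarith [quasiOrbit_le_one β n, orbit_nonneg (β := β) hx n]

/-- An orbit starting at height `≥ 1` overtakes its own height: where its digits first drop below
those of the quasi-greedy orbit of `1`, its lead has grown by at least the factor `β`. -/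
lemma IsOrbit.exists_lead_growth (hβ : 1 < β) {s : ℕ → ℕ} {x : ℕ → ℝ} (hx : IsOrbit β s x)
    (hs : LexLT s (quasiGreedy β)) (h0 : 1 ≤ x 0) : ∃ n, β * (x 0 - 1) < x n - 1 := by
  obtain ⟨n, heq, hlt⟩ := hs
  have hdiff := hx.sub_succ_of_first_diff (isOrbit_quasiOrbit hβ) heq
  rw [quasiOrbit_zero] at hdiff
  have hdigit : (s n : ℝ) + 1 ≤ quasiGreedy β n := mod_cast hlt
  have hpow : β * (x 0 - 1) ≤ β ^ (n + 1) * (x 0 - 1) :=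
    mul_le_mul_of_nonneg_right (le_self_pow₀ hβ.le n.succ_ne_zero) (sub_nonneg.2 h0)
  exact ⟨n + 1, by linarith [quasiOrbit_pos hβ (n + 1)]⟩

lemma val_lt_one (hβ : 1 < β) {s : ℕ → ℕ}
    (h : ∀ k, LexLT (fun i => s (k + i)) (quasiGreedy β)) : val β s < 1 := by
  have hc : ∀ i, s i ≤ quasiGreedy β 0 := fun k => (h k).apply_zero_le
  have horbit := isOrbit_val hβ hc
  set x : ℕ → ℝ := fun k => val β fun i => s (k + i)
  have hgrowth : ∀ k, 1 ≤ x k → ∃ n, β * (x k - 1) < x n - 1 := fun k hk =>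
    let ⟨n, hn⟩ := (horbit.shift k).exists_lead_growth hβ (h k) hk
    ⟨k + n, hn⟩
  have hbdd : BddAbove (Set.range x) := ⟨val β fun _ => quasiGreedy β 0, by
    rintro _ ⟨k, rfl⟩
    exact val_mono hβ (fun i => hc _) fun _ => le_rfl⟩
  have hx0 : x 0 = val β s := by simp [x]
  rw [← hx0]
  by_contra! hge
  obtain ⟨n, hn⟩ := hgrowth 0 hge
  have hlead : 0 < x n - 1 :=
    (mul_nonneg (one_pos.trans hβ).le (sub_nonneg.2 hge)).trans_lt hn
  -- The supremum `M` of the orbit exceeds `1`, yet the growth bounds it by `1 + (M - 1) / β`.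
  have hsup : ⨆ k, x k ≤ 1 + ((⨆ k, x k) - 1) / β := by
    refine ciSup_le fun k => ?_
    rcases le_total 1 (x k) with hk | hk
    · obtain ⟨l, hl⟩ := hgrowth k hk
      rw [← sub_le_iff_le_add', le_div_iff₀' (one_pos.trans hβ)]
      linarith [le_ciSup hbdd l]
    · have : 0 ≤ ((⨆ k, x k) - 1) / β :=
        div_nonneg (by linarith [le_ciSup hbdd n]) (one_pos.trans hβ).le
      linarith
  have hM : 0 < (⨆ k, x k) - 1 := by linarith [le_ciSup hbdd n]
  linarith [div_lt_self hM hβ]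

/-! ### Tails of sequences of the compactum -/

/-- The value `∑_{i ≥ 1} ε_{j+i} β^{-i}` of the digits of `ε` after the index `j`. -/
noncomputable def tailVal (β : ℝ) (ε : ℤ → ℕ) (j : ℤ) : ℝ := val β fun i => ε (1 + i + j)

lemma tailVal_nonneg (hβ : 1 < β) (ε : ℤ → ℕ) (j : ℤ) : 0 ≤ tailVal β ε j := val_nonneg hβ _

section Tails

variable {ε : ℤ → ℕ}

lemma tailVal_lt_one (hβ : 1 < β) (hε : ε ∈ compactum β) (j : ℤ) : tailVal β ε j < 1 := by
  refine val_lt_one hβ fun k => ?_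
  convert hε (1 + k + j) using 3 with i
  push_cast
  ring

lemma tailVal_succ (hβ : 1 < β) (hε : ε ∈ compactum β) (j : ℤ) :
    tailVal β ε (j + 1) = β * tailVal β ε j - ε (1 + j) := by
  have hstep := val_succ hβ (s := fun i => ε (1 + i + j)) fun i => apply_le_of_mem_compactum hε _
  simp only [Nat.cast_zero, add_zero] at hstep
  rw [tailVal, tailVal, ← hstep]
  exact congrArg (val β) (funext fun i => congrArg ε (by push_cast; ring))

lemma apply_eq_floor_tailVal (hβ : 1 < β) (hε : ε ∈ compactum β) (j : ℤ) :
    ε (1 + j) = ⌊β * tailVal β ε j⌋₊ := by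
  have hstep := tailVal_succ hβ hε j
  have hlt := tailVal_lt_one hβ hε (j + 1)
  have hnonneg := tailVal_nonneg hβ ε (j + 1)
  refine ((Nat.floor_eq_iff (mul_nonneg (one_pos.trans hβ).le (tailVal_nonneg hβ ε j))).2
    ⟨?_, ?_⟩).symm <;> linarith

lemma tailVal_succ_eq_fract (hβ : 1 < β) (hε : ε ∈ compactum β) (j : ℤ) :
    tailVal β ε (j + 1) = Int.fract (β * tailVal β ε j) := by
  rw [fract_eq_sub_natFloor (mul_nonneg (one_pos.trans hβ).le (tailVal_nonneg hβ _ _)),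
    ← apply_eq_floor_tailVal hβ hε, tailVal_succ hβ hε]

lemma orbit_tailVal (hβ : 1 < β) (hε : ε ∈ compactum β) (j : ℤ) (n : ℕ) :
    orbit β (tailVal β ε j) n = tailVal β ε (j + n) := by
  induction n with
  | zero => simp [orbit_zero]
  | succ n ih => rw [orbit_succ, ih, ← tailVal_succ_eq_fract hβ hε, Nat.cast_succ, add_assoc]

lemma digit_tailVal (hβ : 1 < β) (hε : ε ∈ compactum β) (j : ℤ) (n : ℕ) :
    digit β (tailVal β ε j) n = ε (1 + (j + n)) := by
  rw [digit_eq, orbit_tailVal hβ hε, apply_eq_floor_tailVal hβ hε]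

end Tails

/-- The greedy expansion of `x ∈ [0, 1)` as a two-sided sequence; the first digit has index `1`. -/
noncomputable def expansion (β x : ℝ) (k : ℤ) : ℕ := if k ≤ 0 then 0 else digit β x (k - 1).toNat

lemma expansion_of_nonpos (β x : ℝ) {k : ℤ} (hk : k ≤ 0) : expansion β x k = 0 := if_pos hk

lemma expansion_one_add (β x : ℝ) (n : ℕ) : expansion β x (1 + n) = digit β x n := by
  rw [expansion, if_neg (by omega)]
  congr
  omega

lemma expansion_mem_compactum (hβ : 1 < β) {x : ℝ} (hx : 0 ≤ x) (hx1 : x < 1) :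
    expansion β x ∈ compactum β := by
  intro n
  rcases le_or_gt n 0 with hn | hn
  · refine ⟨0, by simp, ?_⟩
    simp only [Nat.cast_zero, add_zero, expansion_of_nonpos β x hn]
    exact quasiGreedy_zero_pos hβ
  · obtain ⟨k, rfl⟩ : ∃ k : ℕ, n = 1 + k := ⟨(n - 1).toNat, by omega⟩
    convert lexLT_digit hβ (orbit_nonneg (β := β) hx k) (orbit_lt_one hx1 k) using 1
    funext i
    rw [← digit_add, ← expansion_one_add]
    congr 1
    push_cast
    ring

/-! ### The closed compactum -/

/-- The set of sequences all of whose tails are lexicographically at most `d`. Unlike the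
`β`-compactum, it is compact. -/
def closedCompactum (β : ℝ) : Set (ℤ → ℕ) :=
  {ε | ∀ n : ℤ, ¬ LexLT (quasiGreedy β) fun i : ℕ => ε (n + i)}

lemma compactum_subset_closedCompactum : compactum β ⊆ closedCompactum β :=
  fun _ h n => (h n).asymm

lemma apply_le_of_mem_closedCompactum {ε : ℤ → ℕ} (hε : ε ∈ closedCompactum β) (k : ℤ) :
    ε k ≤ quasiGreedy β 0 := by
  by_contra hk
  exact hε k ⟨0, by simp, by simpa using hk⟩

lemma isOpen_setOf_lexLT (d : ℕ → ℕ) : IsOpen {s | LexLT d s} := by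
  have hunion : {s | LexLT d s} =
      ⋃ n, (⋂ i ∈ Finset.range n, {s | d i = s i}) ∩ {s : ℕ → ℕ | d n < s n} := by
    ext s
    simp [LexLT]
  rw [hunion]
  refine isOpen_iUnion fun n => (isOpen_biInter_finset fun i _ => ?_).inter ?_
  · exact (isOpen_discrete {a : ℕ | d i = a}).preimage (continuous_apply i)
  · exact (isOpen_discrete {a : ℕ | d n < a}).preimage (continuous_apply n)

lemma isClosed_closedCompactum (β : ℝ) : IsClosed (closedCompactum β) := by
  rw [closedCompactum, Set.ofPred_forall]
  refine isClosed_iInter fun n => ((isOpen_setOf_lexLT _).preimage ?_).isClosed_compl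
  exact continuous_pi fun i => continuous_apply (n + i : ℤ)

lemma isCompact_closedCompactum (β : ℝ) : IsCompact (closedCompactum β) :=
  (isCompact_univ_pi fun _ : ℤ => (Set.finite_Iic (quasiGreedy β 0)).isCompact).of_isClosed_subset
    (isClosed_closedCompactum β) fun _ hε k _ => apply_le_of_mem_closedCompactum hε k

lemma isClosed_image_closedCompactum (hβ : IsPisotUnit β) :
    IsClosed ((fun ε => torusMk (realCode β ε)) '' closedCompactum β) :=
  ((isCompact_closedCompactum β).image_of_continuousOn <| continuous_torusMk.comp_continuousOn <|
    (continuousOn_realCode hβ _).mono fun _ hε => apply_le_of_mem_closedCompactum hε).isClosed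

/-! ### Density of the unstable line -/

lemma norm_torusMk_le {m : ℕ} (v : Fin m → ℝ) : ‖torusMk v‖ ≤ ‖v‖ :=
  (pi_norm_le_iff_of_nonneg (norm_nonneg v)).2 fun i =>
    QuotientAddGroup.norm_mk_le_norm.trans (norm_le_pi_norm v i)

lemma eventually_norm_toralMap_stab_lt (hβ : IsPisotUnit β) (R : ℝ) {δ : ℝ} (hδ : 0 < δ) :
    ∀ᶠ n : ℕ in atTop, ∀ v, ‖v‖ ≤ R →
      ‖toralMap (companion β ^ (n : ℤ)) (torusMk (stab β v))‖ < δ := by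
  obtain ⟨ρ, D, h0, h1, hD, hcontr⟩ := exists_contraction hβ
  have hlim : Tendsto (fun n : ℕ => D * ρ ^ n * R) atTop (𝓝 0) := by
    simpa using ((tendsto_pow_atTop_nhds_zero_of_lt_one h0.le h1).const_mul D).mul_const R
  filter_upwards [hlim.eventually (gt_mem_nhds hδ)] with n hn v hv
  rw [toralMap_torusMk, zpow_natCast]
  refine ((norm_torusMk_le _).trans (hcontr v n)).trans_lt (lt_of_le_of_lt ?_ hn)
  gcongr

lemma exists_bounded_lift (hβ : IsPisotUnit β) : ∃ R : ℝ, ∀ θ : Torus β,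
    ∃ v, torusMk v = θ ∧ ‖v‖ ≤ R ∧ 0 ≤ unstable β v := by
  obtain ⟨C, hC⟩ := isCompact_univ.exists_bound_of_continuousOn
    (continuous_id (X := Torus β)).continuousOn
  set L := LinearMap.toContinuousLinearMap (unstable β)
  set j : ℤ := ⌈‖L‖ * C⌉
  refine ⟨C + ‖intVec (j • unitVec β)‖, fun θ => ?_⟩
  obtain ⟨v, rfl⟩ := torusMk_surjective θ
  have hred : ‖reduce v‖ ≤ C := norm_torusMk v ▸ hC _ (Set.mem_univ _)
  refine ⟨reduce v + intVec (j • unitVec β), ?_, (norm_add_le _ _).trans (by gcongr), ?_⟩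
  · rw [map_add, torusMk_intVec, add_zero, torusMk_reduce]
  · have hbound : |unstable β (reduce v)| ≤ ‖L‖ * C :=
      (L.le_opNorm _).trans (mul_le_mul_of_nonneg_left hred (norm_nonneg _))
    have hceil : ‖L‖ * C ≤ j := Int.le_ceil _
    rw [map_add, map_zsmul, map_zsmul, unstable_unitVec hβ, zsmul_one]
    linarith [neg_le_of_abs_le hbound]

lemma exists_toralMap_baseVec_close (hβ : IsPisotUnit β) (θ : Torus β) {δ : ℝ} (hδ : 0 < δ) :
    ∃ x : ℝ, 0 ≤ x ∧ x < 1 ∧ ∃ n : ℕ,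
      ‖θ - toralMap (companion β ^ (n : ℤ)) (torusMk (x • baseVec β))‖ < δ := by
  obtain ⟨R, hR⟩ := exists_bounded_lift hβ
  obtain ⟨n, hn⟩ := (eventually_norm_toralMap_stab_lt hβ R hδ).exists
  obtain ⟨v, hv, hvR, hv0⟩ := hR (toralMap (companion β ^ (-(n : ℤ))) θ)
  obtain ⟨k, hk⟩ := pow_unbounded_of_one_lt (unstable β v) hβ.one_lt
  have hpow : 0 < β ^ k := pow_pos hβ.pos k
  have hθ : toralMap (companion β ^ (n : ℤ)) (torusMk v) = θ := by
    rw [hv, ← toralMap_zpow_add hβ, add_neg_cancel, zpow_zero, toralMap_one]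
  have hline : matAct ℝ (companion β ^ (k : ℤ)) ((unstable β v / β ^ k) • baseVec β) =
      unstable β v • baseVec β := by
    rw [map_smul, companion_zpow_baseVec hβ, smul_smul, zpow_natCast, div_mul_cancel₀ _ hpow.ne']
  refine ⟨unstable β v / β ^ k, div_nonneg hv0 hpow.le, (div_lt_one hpow).2 hk, n + k, ?_⟩
  rw [Nat.cast_add, toralMap_zpow_add hβ, toralMap_torusMk _ (_ • _), hline, ← hθ,
    ← toralHom_apply, ← toralHom_apply, ← map_sub, ← map_sub, ← stab_apply]
  exact hn v hvR

lemma exists_mem_closedCompactum_torusMk_realCode_eq (hβ : IsPisotUnit β) (θ : Torus β) :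
    ∃ ε ∈ closedCompactum β, torusMk (realCode β ε) = θ := by
  suffices h : θ ∈ closure ((fun ε => torusMk (realCode β ε)) '' closedCompactum β) by
    rwa [(isClosed_image_closedCompactum hβ).closure_eq] at h
  refine Metric.mem_closure_iff.2 fun δ hδ => ?_
  obtain ⟨x, hx, hx1, n, hn⟩ := exists_toralMap_baseVec_close hβ θ hδ
  have hmem := expansion_mem_compactum hβ.one_lt hx hx1
  have hc := apply_le_of_mem_compactum hmem
  have hdigits : (fun i : ℕ => expansion β x (1 + i)) = digit β x := funext (expansion_one_add β x)
  refine ⟨_, ⟨fun k => expansion β x (k + n), fun k => ?_, rfl⟩, ?_⟩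
  · convert compactum_subset_closedCompactum hmem (k + n) using 4
    ring
  · beta_reduce
    rwa [torusMk_realCode_shift hβ hc,
      realCode_of_nonpos hβ hc fun k hk => expansion_of_nonpos β x hk, hdigits,
      val_digit hβ.one_lt hx hx1, dist_eq_norm]

/-! ### Carrying: from the closed compactum to the compactum -/

lemma realCode_eq_of_val_eq (hβ : IsPisotUnit β) {ε δ : ℤ → ℕ} {c : ℕ} (hε : ∀ k, ε k ≤ c)
    (hδ : ∀ k, δ k ≤ c) (h : ∀ k ≤ 0, ε k = δ k)
    (hv : val β (fun i => ε (1 + i)) = val β fun i => δ (1 + i)) :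
    realCode β ε = realCode β δ := by
  have hsε := summable_val hβ.one_lt fun i : ℕ => hε (1 + i)
  have hsδ := summable_val hβ.one_lt fun i : ℕ => hδ (1 + i)
  rw [← sub_eq_zero, val, val, ← hsε.tsum_sub hsδ] at hv
  rw [← sub_eq_zero, realCode, realCode,
    ← (summable_realCode hβ hε).tsum_sub (summable_realCode hβ hδ),
    tsum_int_of_nonpos fun k hk => by rw [h k hk, sub_self], ← zero_smul ℝ (baseVec β), ← hv,
    ← (hsε.sub hsδ).tsum_smul_const]
  refine tsum_congr fun i => ?_
  rw [liftTerm, if_pos (by positivity), zpow_neg_one_add, smul_smul, smul_smul, sub_smul]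

lemma val_eq_of_carry (hβ : 1 < β) {s t : ℕ → ℕ} {c : ℕ} (hs : ∀ i, s i ≤ c) (ht : ∀ i, t i ≤ c)
    (hs1 : (fun i => s (i + 1)) = quasiGreedy β) (ht1 : ∀ i, t (i + 1) = 0)
    (h0 : t 0 = s 0 + 1) : val β t = val β s := by
  have hval_s := val_succ hβ hs
  have hval_t := val_succ hβ ht
  have hzero : (val β fun _ => 0) = 0 := by simp [val]
  rw [hs1, val_quasiGreedy hβ] at hval_s
  simp only [ht1, hzero, h0, Nat.cast_add, Nat.cast_one] at hval_t
  exact mul_left_cancel₀ (one_pos.trans hβ).ne' (by linarith)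

/-- If the digits from `n` on are those of `d`, which have the value `1`, they may be replaced by
zeros and a carry into the digit at `n - 1`. -/
def carry (ε : ℤ → ℕ) (n k : ℤ) : ℕ :=
  if k < n - 1 then ε k else if k = n - 1 then ε k + 1 else 0

section Carry

variable {ε : ℤ → ℕ} {n : ℤ}

lemma carry_of_lt {k : ℤ} (hk : k < n - 1) : carry ε n k = ε k := if_pos hk

lemma carry_of_eq {k : ℤ} (hk : k = n - 1) : carry ε n k = ε k + 1 := by
  rw [carry, if_neg (by omega), if_pos hk]

lemma carry_of_ge {k : ℤ} (hk : n ≤ k) : carry ε n k = 0 := by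
  rw [carry, if_neg (by omega), if_neg (by omega)]

lemma lexLT_of_le_of_eq_zero {s d : ℕ → ℕ} {i : ℕ} (heq : ∀ k < i, s k = d k) (hle : s i ≤ d i)
    (hzero : ∀ k > i, s k = 0) (hd : ∃ k > i, d k ≠ 0) : LexLT s d := by
  classical
  rcases hle.lt_or_eq with hlt | hi
  · exact ⟨i, heq, hlt⟩
  · obtain ⟨hgt, hne⟩ := Nat.find_spec hd
    refine ⟨Nat.find hd, fun k hk => ?_, by rw [hzero _ hgt]; exact Nat.pos_of_ne_zero hne⟩
    rcases lt_trichotomy k i with hki | rfl | hki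
    · exact heq k hki
    · exact hi
    · rw [hzero k hki, not_ne_iff.1 fun h => Nat.find_min hd hk ⟨hki, h⟩]

/-- If the tail from `n` on is `d`, every earlier tail that is smaller than `d` is smaller because
of a digit before `n`: the tails of `d` do not exceed `d`. -/
lemma exists_first_diff_lt (hβ : 1 < β) (hn : (fun i : ℕ => ε (n + i)) = quasiGreedy β) {j : ℤ}
    (hj : j ≤ n) (hlt : LexLT (fun i : ℕ => ε (j + i)) (quasiGreedy β)) :
    ∃ i : ℕ, j + i < n ∧ (∀ k < i, ε (j + k) = quasiGreedy β k) ∧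
      ε (j + i) < quasiGreedy β i := by
  obtain ⟨i, heq, hi⟩ := hlt
  refine ⟨i, not_le.1 fun hge => ?_, heq, hi⟩
  obtain ⟨q, rfl⟩ : ∃ q : ℕ, n = j + q := ⟨(n - j).toNat, by omega⟩
  obtain ⟨t, rfl⟩ : ∃ t : ℕ, i = q + t := ⟨i - q, by omega⟩
  have hd : ∀ k, quasiGreedy β k = ε (j + (q + k : ℕ)) := fun k => by
    rw [← congrFun hn k, Nat.cast_add, add_assoc]
  refine not_lexLT_quasiGreedy_shift hβ q ⟨t, fun k hk => ?_, ?_⟩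
  · rw [hd k]
    exact heq (q + k) (by omega)
  · rw [hd t]
    exact hi

lemma carry_mem_compactum (hβ : 1 < β) (hε : ε ∈ closedCompactum β)
    (hn : (fun i : ℕ => ε (n + i)) = quasiGreedy β)
    (hmin : ∀ j < n, (fun i : ℕ => ε (j + i)) ≠ quasiGreedy β) : carry ε n ∈ compactum β := by
  intro j
  rcases le_or_gt n j with hj | hj
  · exact ⟨0, by simp, (carry_of_ge (by simpa using hj)).trans_lt (quasiGreedy_zero_pos hβ)⟩
  obtain ⟨i, hin, heq, hlt⟩ := exists_first_diff_lt hβ hn hj.le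
    ((lexLT_trichotomy _ _).resolve_right (not_or.2 ⟨hmin j hj, hε j⟩))
  have hbefore : ∀ k < i, carry ε n (j + k) = quasiGreedy β k := fun k hk => by
    rw [carry_of_lt (by omega), heq k hk]
  rcases (Int.le_sub_one_of_lt hin).lt_or_eq with hi | hi
  · exact ⟨i, hbefore, (carry_of_lt hi).trans_lt hlt⟩
  · refine lexLT_of_le_of_eq_zero hbefore ?_ (fun k hk => carry_of_ge (by omega))
      (exists_quasiGreedy_ne_zero hβ (i + 1))
    rw [carry_of_eq hi]
    exact hlt

lemma torusMk_realCode_carry (hβ : IsPisotUnit β) (hε : ε ∈ closedCompactum β)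
    (hn : (fun i : ℕ => ε (n + i)) = quasiGreedy β) :
    torusMk (realCode β (carry ε n)) = torusMk (realCode β ε) := by
  have hle := apply_le_of_mem_closedCompactum hε
  have hcarry : ∀ k, carry ε n k ≤ quasiGreedy β 0 + 1 := fun k => by
    have := hle k
    unfold carry
    split_ifs <;> omega
  replace hle : ∀ k, ε k ≤ quasiGreedy β 0 + 1 := fun k => (hle k).trans (Nat.le_succ _)
  -- Shifting by `n - 2` moves the carried digit to the index `1`.
  apply toralMap_zpow_injective hβ (n - 2)
  rw [← torusMk_realCode_shift hβ hle, ← torusMk_realCode_shift hβ hcarry]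
  refine congrArg torusMk (realCode_eq_of_val_eq hβ (fun k => hcarry _) (fun k => hle _)
    (fun k hk => carry_of_lt (by omega)) ?_)
  refine val_eq_of_carry hβ.one_lt (fun i => hle _) (fun i => hcarry _) ?_
    (fun i => carry_of_ge (by omega)) (carry_of_eq (by push_cast; ring))
  rw [← hn]
  exact funext fun i => congrArg ε (by push_cast; ring)

lemma torusMk_realCode_eq_zero (hβ : IsPisotUnit β) (hc : ∀ k, ε k ≤ quasiGreedy β 0)
    (h : ∀ b : ℤ, ∃ n < b, (fun i : ℕ => ε (n + i)) = quasiGreedy β) :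
    torusMk (realCode β ε) = 0 := by
  refine norm_le_zero_iff.1 (le_of_forall_pos_le_add fun δ hδ => ?_)
  rw [zero_add]
  obtain ⟨N, hN⟩ := eventually_atTop.1 (eventually_norm_toralMap_stab_lt hβ
    ((∑' k, (quasiGreedy β 0 : ℝ) * ‖liftTerm β k‖) + ‖intVec (unitVec β)‖) hδ)
  obtain ⟨n, hn, htail⟩ := h (1 - N)
  obtain ⟨k, rfl⟩ : ∃ k : ℕ, n = 1 + -(k : ℤ) := ⟨(1 - n).toNat, by omega⟩
  set w := realCode β fun i => ε (i + -(k : ℤ)) with hw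
  have hunst : unstable β w = 1 := by
    rw [hw, unstable_realCode hβ fun i => hc _, ← val_quasiGreedy hβ.one_lt, ← htail]
    exact congrArg (val β) (funext fun i => congrArg ε (by ring))
  have hstab : stab β (w - intVec (unitVec β)) = w - intVec (unitVec β) := by
    rw [stab_apply, map_sub, hunst, unstable_unitVec hβ, sub_self, zero_smul, sub_zero]
  have hcode : toralMap (companion β ^ (k : ℤ)) (torusMk (stab β (w - intVec (unitVec β)))) =
      torusMk (realCode β ε) := by
    rw [hstab, map_sub, torusMk_intVec, sub_zero, hw, torusMk_realCode_shift hβ hc,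
      ← toralMap_zpow_add hβ, add_neg_cancel, zpow_zero, toralMap_one]
  rw [← hcode]
  refine (hN k (by omega) _ ((norm_sub_le _ _).trans ?_)).le
  gcongr
  exact norm_realCode_le hβ fun i => hc _

end Carry

lemma zero_mem_compactum (hβ : 1 < β) : (fun _ => 0) ∈ compactum β :=
  fun _ => ⟨0, by simp, quasiGreedy_zero_pos hβ⟩

lemma phiZero_surjective (hβ : IsPisotUnit β) : Function.Surjective (phiZero β) := by
  intro θ
  obtain ⟨ε, hε, rfl⟩ := exists_mem_closedCompactum_torusMk_realCode_eq hβ θ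
  by_cases hex : ∃ n : ℤ, (fun i : ℕ => ε (n + i)) = quasiGreedy β
  · by_cases hbdd : ∃ b : ℤ, ∀ n : ℤ, (fun i : ℕ => ε (n + i)) = quasiGreedy β → b ≤ n
    · obtain ⟨n, hn, hmin⟩ := Int.exists_least_of_bdd hbdd hex
      have hmem := carry_mem_compactum hβ.one_lt hε hn fun j hj hj' => (hmin j hj').not_gt hj
      exact ⟨⟨_, hmem⟩, by rw [phiZero_eq hβ, torusMk_realCode_carry hβ hε hn]⟩
    · push Not at hbdd
      refine ⟨⟨_, zero_mem_compactum hβ.one_lt⟩, ?_⟩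
      rw [phiZero_eq hβ, torusMk_realCode_eq_zero hβ (apply_le_of_mem_closedCompactum hε) fun b =>
        (hbdd b).imp fun _ => And.symm]
      simp [realCode]
  · exact ⟨⟨ε, fun n => (lexLT_trichotomy _ _).resolve_right
      (not_or.2 ⟨fun h => hex ⟨n, h⟩, hε n⟩)⟩, phiZero_eq hβ _⟩

/-! ### Periodicity over the kernel of `g'(T)` -/

lemma exists_period_of_finite_range {α : Type*} {f : α → α} {x : ℤ → α}
    (hx : ∀ j, x (j + 1) = f (x j)) (hfin : (Set.range x).Finite) :
    ∃ p : ℕ, 0 < p ∧ ∀ j, x (j + p) = x j := by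
  have : Finite (Set.range x) := hfin
  let g : Set.range x → Set.range x := Subtype.map f <| by
    rintro _ ⟨j, rfl⟩
    exact ⟨j + 1, hx j⟩
  have hg : Function.Surjective g := by
    rintro ⟨_, j, rfl⟩
    exact ⟨⟨x (j - 1), j - 1, rfl⟩, Subtype.ext ((hx _).symm.trans (by rw [sub_add_cancel]))⟩
  let σ : Equiv.Perm (Set.range x) :=
    Equiv.ofBijective g ⟨Finite.injective_iff_surjective.2 hg, hg⟩
  have hσ : ∀ (n : ℕ) j, ((σ ^ n) ⟨x j, j, rfl⟩ : Set.range x).1 = x (j + n) := by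
    intro n j
    induction n with
    | zero => simp
    | succ n ih =>
      rw [pow_succ', Equiv.Perm.mul_apply, Nat.cast_succ, ← add_assoc, hx, ← ih]
      rfl
  refine ⟨orderOf σ, orderOf_pos σ, fun j => ?_⟩
  rw [← hσ, pow_orderOf_eq_one, Equiv.Perm.one_apply]

lemma finite_setOf_mem_kerLattice_norm_le (hβ : IsPisotUnit β) (R : ℝ) :
    {u | u ∈ kerLattice β ∧ ‖u‖ ≤ R}.Finite := by
  set L := LinearMap.toContinuousLinearMap (matAct ℝ (derivMat β))
  have hball : (Metric.closedBall (0 : Fin (deg β) → ℤ) (‖L‖ * R)).Finite :=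
    (isCompact_closedBall _ _).finite_of_discrete
  refine ((hball.image intVec).preimage
    (matAct_bijective (det_derivMat_ne_zero hβ)).1.injOn).subset ?_
  rintro u ⟨hu, hR⟩
  obtain ⟨z, hz⟩ := mem_kerLattice_iff.1 hu
  refine ⟨z, mem_closedBall_zero_iff.2 ?_, hz.symm⟩
  calc ‖z‖ = ‖intVec z‖ := rfl
    _ = ‖L u‖ := by rw [← hz]; rfl
    _ ≤ ‖L‖ * R := (L.le_opNorm u).trans (by gcongr)

lemma toralMap_mem_ker_derivMat (j : ℤ) {x : Torus β} (hx : x ∈ (toralHom (derivMat β)).ker) :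
    toralMap (companion β ^ j) x ∈ (toralHom (derivMat β)).ker := by
  have hcomm : Commute (derivMat β) (companion β) := by
    have h := congrArg (aeval (companion β)) (mul_comm (derivative (minpoly ℤ β)) X)
    rwa [map_mul, map_mul, aeval_X] at h
  rw [AddMonoidHom.mem_ker, toralHom_apply] at hx ⊢
  rw [← toralMap_mul, (Matrix.Commute.zpow_right hcomm j).eq, toralMap_mul, hx, ← toralHom_apply,
    map_zero]

lemma unstable_realCode_shift (hβ : IsPisotUnit β) (ε : compactum β) (j : ℤ) :
    unstable β (realCode β fun k => ε.1 (k + j)) = tailVal β ε.1 j :=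
  unstable_realCode hβ fun _ => apply_le_of_mem_compactum ε.2 _

lemma realCode_shift_mem_kerLattice (hβ : IsPisotUnit β) {ε : compactum β}
    (hε : phiZero β ε ∈ (toralHom (derivMat β)).ker) (j : ℤ) :
    (realCode β fun k => ε.1 (k + j)) ∈ kerLattice β := by
  change torusMk _ ∈ (toralHom (derivMat β)).ker
  rw [torusMk_realCode_shift hβ (apply_le_of_mem_compactum ε.2), ← phiZero_eq hβ]
  exact toralMap_mem_ker_derivMat j hε

lemma exists_period (hβ : IsPisotUnit β) {ε : compactum β}
    (hε : phiZero β ε ∈ (toralHom (derivMat β)).ker) :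
    ∃ p : ℕ, 0 < p ∧ ∀ k : ℤ, ε.1 (k + p) = ε.1 k := by
  have hfin : (Set.range (tailVal β ε.1)).Finite := by
    refine ((finite_setOf_mem_kerLattice_norm_le hβ
      (∑' k, (quasiGreedy β 0 : ℝ) * ‖liftTerm β k‖)).image (unstable β)).subset ?_
    rintro _ ⟨j, rfl⟩
    exact ⟨_, ⟨realCode_shift_mem_kerLattice hβ hε j,
      norm_realCode_le hβ fun _ => apply_le_of_mem_compactum ε.2 _⟩, unstable_realCode_shift hβ ε j⟩
  obtain ⟨p, hp, hper⟩ :=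
    exists_period_of_finite_range (f := fun y => Int.fract (β * y))
      (tailVal_succ_eq_fract hβ.one_lt ε.2) hfin
  refine ⟨p, hp, fun k => ?_⟩
  have hdigit := apply_eq_floor_tailVal hβ.one_lt ε.2
  have hk := (hdigit (k - 1 + p)).trans (by rw [hper, ← hdigit])
  convert hk using 2 <;> ring

/-! ### The fibres of `φ₀` over the kernel -/

lemma isBetaExpansion_expansion {x : ℝ} (hx : 0 ≤ x) (hx1 : x < 1) :
    IsBetaExpansion β x (expansion β x) := by
  refine ⟨0, hx, by simpa using hx1, fun n => ?_,
    fun k hk => expansion_of_nonpos β x (by simpa using hk)⟩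
  rw [pow_zero, div_one, ← expansion_one_add, Nat.cast_zero, sub_zero, add_comm]

lemma mem_symbolicClass_symm_phiZero (hβ : IsPisotUnit β) {ε : compactum β}
    (hε : phiZero β ε ∈ (toralHom (derivMat β)).ker) :
    ε ∈ symbolicClass β ((pisotEquiv hβ).symm ⟨phiZero β ε, hε⟩) := by
  set ξ : pisotP β := latticeEquiv hβ ⟨_, realCode_shift_mem_kerLattice hβ hε 0⟩
  have hξ : (ξ : ℝ) = tailVal β ε.1 0 := unstable_realCode_shift hβ ε 0
  have h0 : 0 ≤ (ξ : ℝ) := hξ ▸ tailVal_nonneg hβ.one_lt ε.1 0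
  have h1 : (ξ : ℝ) < 1 := hξ ▸ tailVal_lt_one hβ.one_lt ε.2 0
  refine ⟨exists_period hβ hε, ξ, ?_, h0, _, isBetaExpansion_expansion h0 h1, 1, fun k hk => ?_⟩
  · rw [AddEquiv.eq_symm_apply, pisotEquiv_mk]
    refine Subtype.ext ((pisotHom_latticeEquiv hβ _).trans ?_)
    simp only [add_zero, phiZero_eq hβ]
  · obtain ⟨n, rfl⟩ : ∃ n : ℕ, k = 1 + n := ⟨(k - 1).toNat, by omega⟩
    rw [expansion_one_add, hξ, digit_tailVal hβ.one_lt ε.2, zero_add]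

lemma pow_mul_sub_orbit_mem (hβ : 1 < β) {x : ℝ} (hx : 0 ≤ x) (n : ℕ) :
    β ^ n * x - orbit β x n ∈ ringZ β := by
  induction n with
  | zero => simp [orbit_zero, zero_mem]
  | succ n ih =>
    have h : β * (β ^ n * x - orbit β x n) + digit β x n ∈ Algebra.adjoin ℤ {β} :=
      add_mem (mul_mem (Algebra.self_mem_adjoin_singleton ℤ β) ih) (natCast_mem _ _)
    change _ ∈ Algebra.adjoin ℤ {β}
    rw [isOrbit_orbit hβ hx]
    convert h using 1
    ring

lemma tailVal_sub_pow_mul_mem (hβ : 1 < β) {ε δ : ℤ → ℕ} {ξ : ℝ} (hδ : IsBetaExpansion β ξ δ)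
    {n : ℕ} (hn : ∀ k > (n : ℤ), ε k = δ k) : tailVal β ε n - β ^ n * ξ ∈ ringZ β := by
  obtain ⟨N, h0, h1, hdigit, -⟩ := hδ
  have hpow : 0 < β ^ N := pow_pos (one_pos.trans hβ) N
  have hx : 0 ≤ ξ / β ^ N := div_nonneg h0 hpow.le
  have hx1 : ξ / β ^ N < 1 := (div_lt_one hpow).2 h1
  have htail : tailVal β ε n = orbit β (ξ / β ^ N) (n + N) := by
    rw [← val_digit hβ (orbit_nonneg hx (n + N)) (orbit_lt_one hx1 (n + N)), tailVal]
    congr 1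
    funext i
    rw [← digit_add, ← hdigit, hn _ (by omega)]
    congr 1
    push_cast
    ring
  have hξ : β ^ (n + N) * (ξ / β ^ N) = β ^ n * ξ := by
    rw [pow_add]
    field_simp
  rw [htail, ← hξ, ← neg_sub]
  exact neg_mem (pow_mul_sub_orbit_mem hβ hx (n + N))

lemma tendsto_toralMap_pow_phiZero_sub (hβ : IsPisotUnit β) {ε : compactum β} {ξ : pisotP β}
    {δ : ℤ → ℕ} (hδ : IsBetaExpansion β ξ δ) {K : ℤ} (hK : ∀ k ≥ K, ε.1 k = δ k) :
    Tendsto (fun i : ℕ => toralMap (companion β ^ i) (phiZero β ε - pisotHom hβ ξ))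
      atTop (𝓝 0) := by
  obtain ⟨u, rfl⟩ := (latticeEquiv hβ).surjective ξ
  set n := K.toNat
  set w := (realCode β fun k => ε.1 (k + n)) - matAct ℝ (companion β ^ (n : ℤ)) u
  have hw : unstable β w ∈ ringZ β := by
    rw [map_sub, unstable_realCode_shift hβ, unstable_zpow hβ, zpow_natCast]
    exact tailVal_sub_pow_mul_mem hβ.one_lt hδ fun k hk => hK k (by omega)
  have hmk : torusMk w =
      toralMap (companion β ^ n) (phiZero β ε - pisotHom hβ (latticeEquiv hβ u)) := by
    rw [map_sub, torusMk_realCode_shift hβ (apply_le_of_mem_compactum ε.2), ← toralMap_torusMk,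
      ← phiZero_eq hβ, pisotHom_latticeEquiv, zpow_natCast]
    exact (map_sub (toralHom _) _ _).symm
  rw [← tendsto_add_atTop_iff_nat n]
  simpa only [hmk, ← toralMap_mul, ← pow_add] using (tendsto_toralMap_pow_iff hβ w).2 hw

lemma toralMap_period (hβ : IsPisotUnit β) {ε : compactum β} {p : ℕ}
    (hp : ∀ k : ℤ, ε.1 (k + p) = ε.1 k) (i : ℕ) :
    toralMap (companion β ^ (p * i)) (phiZero β ε) = phiZero β ε := by
  have hper : ∀ k : ℤ, ε.1 (k + (p * i : ℕ)) = ε.1 k := by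
    simpa [mul_comm] using (show Function.Periodic ε.1 (p : ℤ) from hp).nat_mul i
  rw [← zpow_natCast, phiZero_eq hβ, ← torusMk_realCode_shift hβ (apply_le_of_mem_compactum ε.2),
    funext hper]

/-- Under `T^p` the difference of the two points is attracted to `0` but stays in a finite set: the
first point is fixed, and the second remains in the kernel of `g'(T)`. -/
lemma phiZero_eq_pisotHom_of_periodic (hβ : IsPisotUnit β) {ε : compactum β} {ξ : pisotP β} {p : ℕ}
    (hp0 : 0 < p) (hp : ∀ k : ℤ, ε.1 (k + p) = ε.1 k) {δ : ℤ → ℕ} (hδ : IsBetaExpansion β ξ δ)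
    {K : ℤ} (hK : ∀ k ≥ K, ε.1 k = δ k) : phiZero β ε = pisotHom hβ ξ := by
  set y := phiZero β ε
  set z := pisotHom hβ ξ
  have hlim := (tendsto_toralMap_pow_phiZero_sub hβ hδ hK).comp (tendsto_id.const_mul_atTop' hp0)
  set S : Set (Torus β) := (y - ·) '' ((toralHom (derivMat β)).ker : Set (Torus β))
  have hS : S.Finite := (finite_ker_toralHom (det_derivMat_ne_zero hβ)).image _
  have hmem : ∀ i : ℕ, toralMap (companion β ^ (p * i)) (y - z) ∈ S := by
    intro i
    refine ⟨toralMap (companion β ^ (p * i)) z, ?_, ?_⟩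
    · rw [← zpow_natCast]
      exact toralMap_mem_ker_derivMat _ z.2
    · have hy : toralMap (companion β ^ (p * i)) y = y := toralMap_period hβ hp i
      beta_reduce
      rw [← toralHom_apply, ← toralHom_apply, map_sub, toralHom_apply _ y, hy]
  have hnhds : (S \ {0})ᶜ ∈ 𝓝 (0 : Torus β) :=
    (hS.subset Set.sdiff_subset).isClosed.isOpen_compl.mem_nhds (by simp)
  obtain ⟨i, hi⟩ := (hlim.eventually hnhds).exists
  have hzero : toralMap (companion β ^ ((p * i : ℕ) : ℤ)) (y - z) = 0 := by
    rw [zpow_natCast]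
    by_contra hne
    exact hi ⟨hmem i, hne⟩
  exact sub_eq_zero.1 (toralMap_zpow_injective hβ _
    (hzero.trans (map_zero (toralHom (companion β ^ ((p * i : ℕ) : ℤ)))).symm))

lemma mem_symbolicClass_iff (hβ : IsPisotUnit β) (ε : compactum β) (a : PisotGroup β) :
    ε ∈ symbolicClass β a ↔ phiZero β ε = pisotEquiv hβ a := by
  constructor
  · rintro ⟨⟨p, hp0, hp⟩, ξ, rfl, -, δ, hδ, K, hK⟩
    exact phiZero_eq_pisotHom_of_periodic hβ hp0 hp hδ hK
  · intro h
    have hε : phiZero β ε ∈ (toralHom (derivMat β)).ker := h ▸ (pisotEquiv hβ a).2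
    convert mem_symbolicClass_symm_phiZero hβ hε
    rw [AddEquiv.eq_symm_apply]
    exact Subtype.ext h.symm

/-- The bijection `X'_β → 𝕋^m` induced by `φ₀`. -/
noncomputable def codingEquiv (hβ : IsPisotUnit β) : QuotientCompactum β ≃ Torus β :=
  Setoid.quotientKerEquivOfSurjective (phiZero β) (phiZero_surjective hβ)

lemma codingEquiv_toQuotient (hβ : IsPisotUnit β) (ε : compactum β) :
    codingEquiv hβ (toQuotient β ε) = phiZero β ε := rfl

/-- The kernels of `f` and of `f ∘ e` correspond under an isomorphism `e`. -/
def kerCompEquiv {A B C : Type*} [AddCommGroup A] [AddCommGroup B] [AddCommGroup C]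
    (e : A ≃+ B) (f : B →+ C) : f.ker ≃+ (f.comp (e : A →+ B)).ker :=
  (e.symm.addSubgroupMap f.ker).trans
    (AddEquiv.addSubgroupCongr (AddSubgroup.map_equiv_eq_comap_symm _ _))

end PisotCoding

theorem theorem3p1_general (β : ℝ) (hβ : IsPisotUnit β) :
    (∀ ε : compactum β,
      Summable (codingTerm β (xiZero β) ε) ∧ Summable (codingTerm β 1 ε)) ∧
    (∀ ε ε' : compactum β, phiZero β ε = phiZero β ε' → phi β ε = phi β ε') ∧
    ∃ (_ : AddCommGroup (QuotientCompactum β)) (e : QuotientCompactum β ≃+ Torus β),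
      (∀ ε, e (toQuotient β ε) = phiZero β ε) ∧
      ∃ Φ : QuotientCompactum β →+ Torus β,
        (∀ ε, Φ (toQuotient β ε) = phi β ε) ∧
        classSet β '' (Φ.ker : Set (QuotientCompactum β)) = symbolicPisotGroup β ∧
        ∃ γ : PisotGroup β ≃+ Φ.ker,
          ∀ a, classSet β (γ a : QuotientCompactum β) = symbolicClass β a := by
  refine ⟨fun ε => ⟨(hasSum_phiZero hβ ε).summable, (hasSum_phi hβ ε).summable⟩,
    fun ε ε' h => by rw [phi_eq hβ, phi_eq hβ, h], (codingEquiv hβ).addCommGroup, ?_⟩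
  let _ := (codingEquiv hβ).addCommGroup
  let e : QuotientCompactum β ≃+ Torus β := (codingEquiv hβ).addEquiv
  let γ := (pisotEquiv hβ).trans (kerCompEquiv e (toralHom (derivMat β)))
  have hγ : ∀ a, classSet β (γ a) = symbolicClass β a := fun a => by
    ext ε
    rw [mem_symbolicClass_iff hβ]
    exact (codingEquiv hβ).eq_symm_apply
  refine ⟨e, codingEquiv_toQuotient hβ, (toralHom (derivMat β)).comp e,
    fun ε => (phi_eq hβ ε).symm, ?_, γ, hγ⟩
  ext s
  constructor
  · rintro ⟨x, hx, rfl⟩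
    obtain ⟨a, ha⟩ := γ.surjective ⟨x, hx⟩
    exact ⟨a, by rw [← hγ, ha]⟩
  · rintro ⟨a, rfl⟩
    exact ⟨γ a, (γ a).2, hγ a⟩

/-- The group structure on `X'_β` is the one carried over from the torus: it is determined by the
requirement that the bijection `e` induced by `φ₀` be a group isomorphism. -/
theorem theorem3p1 (β : ℝ) (hβ : IsPisotUnit β) (hfin : IsFinitary β) :
    -- the series that define `φ₀` and `φ` converge
    (∀ ε : compactum β,
      Summable (codingTerm β (xiZero β) ε) ∧ Summable (codingTerm β 1 ε)) ∧
    -- `φ` is well defined on the quotient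
    (∀ ε ε' : compactum β, phiZero β ε = phiZero β ε' → phi β ε = phi β ε') ∧
    ∃ (_ : AddCommGroup (QuotientCompactum β)) (e : QuotientCompactum β ≃+ Torus β),
      (∀ ε, e (toQuotient β ε) = phiZero β ε) ∧
      -- the induced map is a homomorphism, with kernel the symbolic Pisot group
      ∃ Φ : QuotientCompactum β →+ Torus β,
        (∀ ε, Φ (toQuotient β ε) = phi β ε) ∧
        classSet β '' (Φ.ker : Set (QuotientCompactum β)) = symbolicPisotGroup β ∧
        -- the group structure that the symbolic Pisot group inherits from the Pisot group through
        -- the bijection `g` is that of the kernel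
        ∃ γ : PisotGroup β ≃+ Φ.ker,
          ∀ a, classSet β (γ a : QuotientCompactum β) = symbolicClass β a :=
  theorem3p1_general β hβ
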